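/- **Setting.** There are finitely many variables $X_i$, each with a finite set of possible values. An *element* is a pair $(i,j)$ with $j$ a value of variable $i$; $\mathcal X$ is the set of elements. An *atomic event* is a set $B\subseteq\mathcal X$ containing no two elements $(i,j),(i,j')$ with $j\ne j'$; it is true if $X_i=j$ for all $(i,j)\in B$. Let $\mathcal B$ be a set of atomic events (the bad events), $L:\mathcal B\to\{1,\dots,K\}$ a labeling, and $\mathcal B_k=L^{-1}(k)$. For each $k$ let $Q_k:2^{\mathcal X}\to[0,1]$ be a fractional hitting set for $\mathcal B_k$, i.e. $\sum_{Y\subseteq B}Q_k(Y)\ge 1$ for all $B\in\mathcal B_k$. Write $i\sim Y$ if $(i,j)\in Y$ for some $j$; $Y\sim Y'$ if $i\sim Y$ and $i\sim Y'$ for some $i$; and $Y\bowtie_k Y'$ if $Y\not\sim Y'$ and $Y,Y'\subseteq B$ for some $B\in\mathcal B_k$. Given reals $\lambda_{i,j}\ge 0$ for $(i,j)\in\mathcal X$, put $\lambda_i=\sum_j\lambda_{i,j}$, $\lambda^Y=\prod_{(i,j)\in Y}\lambda_{i,j}$, $$G_i(Q,\lambda)=\sum_{Y\sim i}Q(Y)\lambda^Y,\qquad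 G(Q,\lambda)=\sum_{Y\subseteq\mathcal X}Q(Y)\lambda^Y,\qquad S_k(\lambda)=\max_{Y:\,Q_k(Y)>0}\ \sum_{Y'\bowtie_k Y}Q_k(Y')\lambda^{Y'}$$ (with $S_k(\lambda)=0$ if no $Y$ has $Q_k(Y)>0$). **Partial Resampling Algorithm (PRA)** with probabilities $p$: draw all $X_i$ independently with $P(X_i=j)=p_{i,j}$. While some bad event is true, select a true $B\in\mathcal B$ arbitrarily (possibly depending on the past and on additional randomness, but not on future random choices); with $k=L(B)$ select one $Y\subseteq B$ with probability $Q_k(Y)/\sum_{Y'\subseteq B}Q_k(Y')$; and draw the variables $i\sim Y$ anew, independently, from $p$. A *resampling* is an iteration in which $Y\neq\emptyset$; if $Q_k(\emptyset)=0$ for all $k$, every iteration is a resampling almost surely. **Theorem.** Suppose that one of the following holds: (a) $S_k(\lambda)<1$ for all $k$, and $\lambda_i\ge 1+\sum_k\dfrac{G_i(Q_k,\lambda)}{1-S_k(\lambda)}$ for all $i$; (b) $G(Q_k,\lambda)<1$ for all $k$, and $\lambda_i\ge 1+\sum_k\dfrac{G_i(Q_k,\lambda)}{1-G(Q_k,\lambda)}$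 for all $i$; (c) the relations $\bowtie$ are null, i.e. $Y\not\bowtie_k Y'$ for all $k$ and all $Y,Y'$ with $Q_k(Y)>0$ and $Q_k(Y')>0$; and $\lambda_i\ge 1+\sum_k G_i(Q_k,\lambda)$ for all $i$. Then the PRA run with $p_{i,j}=\lambda_{i,j}/\lambda_i$ terminates with probability one, in an assignment in which no bad event is true, and the expected number of resamplings is at most $\sum_i\lambda_i$. In particular, if $Q_k(\emptyset)=0$ for all $k$, the expected number of iterations is at most $\sum_i\lambda_i$. -/

import Mathlib

open MeasureTheory
open scoped ENNReal

namespace PRA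

/-- An element is a pair `(i, j)` of a variable `i` and a value `j` that `i` may take. -/
abbrev Elem {ι : Type*} (α : ι → Type*) := Σ i : ι, α i

section Events

variable {ι : Type*} {α : ι → Type*}

/-- An atomic event never prescribes two different values for the same variable. -/
def IsAtomic (B : Finset (Elem α)) : Prop :=
  ∀ (i : ι) (j j' : α i), ⟨i, j⟩ ∈ B → ⟨i, j'⟩ ∈ B → j = j'

/-- The event `⋀_{(i, j) ∈ B} X_i = j` is true of the assignment `x`. -/
def Holds (x : ∀ i, α i) (B : Finset (Elem α)) : Prop :=
  ∀ e ∈ B, x e.1 = e.2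

/-- `i ∼ Y`: the set `Y` involves the variable `i`. -/
def Involves (i : ι) (Y : Finset (Elem α)) : Prop :=
  ∃ j : α i, ⟨i, j⟩ ∈ Y

/-- `Y ∼ Y'`: the two sets overlap in a variable. -/
def Overlap (Y Y' : Finset (Elem α)) : Prop :=
  ∃ i : ι, Involves i Y ∧ Involves i Y'

/-- `Y ⋈_k Y'`: the sets share no variable, and some bad event with label `k` contains both. -/
def Bowtie {K : ℕ} {ℬ : Finset (Finset (Elem α))} (L : ↥ℬ → Fin K) (k : Fin K)
    (Y Y' : Finset (Elem α)) : Prop :=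
  ¬ Overlap Y Y' ∧ ∃ B : ↥ℬ, L B = k ∧ Y ⊆ B.1 ∧ Y' ⊆ B.1

/-- `C : 2^𝒳 → [0, 1]` is a fractional hitting set for a collection of atomic events. -/
structure IsFracHittingSet (C : Finset (Elem α) → ℝ) (𝒞 : Set (Finset (Elem α))) : Prop where
  nonneg : ∀ Y, 0 ≤ C Y
  le_one : ∀ Y, C Y ≤ 1
  hits : ∀ B ∈ 𝒞, 1 ≤ ∑ Y ∈ B.powerset, C Y

/-- `ℬ_k`, the bad events with label `k`. -/
def labelClass {K : ℕ} {ℬ : Finset (Finset (Elem α))} (L : ↥ℬ → Fin K) (k : Fin K) :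
    Set (Finset (Elem α)) :=
  {B | ∃ h : B ∈ ℬ, L ⟨B, h⟩ = k}

end Events

section Weights

variable {ι : Type*} [Fintype ι] {α : ι → Type*} [∀ i, Fintype (α i)]

/-- `v^Y = ∏_{(i, j) ∈ Y} v_{i, j}`. -/
def setPow (v : Elem α → ℝ) (Y : Finset (Elem α)) : ℝ :=
  ∏ e ∈ Y, v e

/-- `λ_i = ∑_j λ_{i, j}`. -/
def rowSum (lam : Elem α → ℝ) (i : ι) : ℝ :=
  ∑ j : α i, lam ⟨i, j⟩

open Classical in
/-- `G_i(Q, λ) = ∑_{Y ∼ i} Q(Y) λ^Y`. -/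
noncomputable def Gvar (C : Finset (Elem α) → ℝ) (lam : Elem α → ℝ) (i : ι) : ℝ :=
  ∑ Y : Finset (Elem α) with Involves i Y, C Y * setPow lam Y

/-- `G(Q, λ) = ∑_Y Q(Y) λ^Y`. -/
noncomputable def Gtot (C : Finset (Elem α) → ℝ) (lam : Elem α → ℝ) : ℝ :=
  ∑ Y : Finset (Elem α), C Y * setPow lam Y

open Classical in
/-- `S_k(λ)`, the maximum over the sets `Y` with `Q_k(Y) > 0` of `∑_{Y' ⋈_k Y} Q_k(Y') λ^{Y'}`.
There are finitely many sets, so the supremum is a maximum; it is `0` if no set has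
`Q_k(Y) > 0`. -/
noncomputable def Smax {K : ℕ} {ℬ : Finset (Finset (Elem α))} (L : ↥ℬ → Fin K)
    (Q : Fin K → Finset (Elem α) → ℝ) (lam : Elem α → ℝ) (k : Fin K) : ℝ :=
  ⨆ Y : {Y : Finset (Elem α) // 0 < Q k Y},
    ∑ Y' : Finset (Elem α) with Bowtie L k Y' Y.1, Q k Y' * setPow lam Y'

open Classical in
/-- The probability that the set `Y` is chosen for resampling when the violated set is `B`.
The value `none` stands for a run that has stopped; the resampled set is then `∅` by
convention. -/
noncomputable def selectProb {K : ℕ} {ℬ : Finset (Finset (Elem α))} (L : ↥ℬ → Fin K)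
    (Q : Fin K → Finset (Elem α) → ℝ) : Option ↥ℬ → Finset (Elem α) → ℝ
  | some B, Y => if Y ⊆ B.1 then Q (L B) Y / ∑ Y' ∈ B.1.powerset, Q (L B) Y' else 0
  | none, Y => if Y = ∅ then 1 else 0

open Classical in
/-- The probability that the assignment `x` becomes `x'` when the variables involved in `Y` are
resampled independently according to `p` and the others keep their values. -/
noncomputable def resampleProb (p : Elem α → ℝ) (x : ∀ i, α i) (Y : Finset (Elem α))
    (x' : ∀ i, α i) : ℝ :=
  ∏ i, if Involves i Y then p ⟨i, x' i⟩ else if x' i = x i then 1 else 0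

end Weights

section Execution

variable {ι : Type*} [Fintype ι] {α : ι → Type*} [∀ i, Fintype (α i)]

/-- The event that the run agrees with `x, v, y` up to the choice of the violated set of
iteration `t`: assignments and violated sets at times `0, …, t`, resampled sets at times
`0, …, t - 1`. -/
def history {ℬ : Finset (Finset (Elem α))} {Ω : Type*} (X : ℕ → Ω → ∀ i, α i)
    (V : ℕ → Ω → Option ↥ℬ) (R : ℕ → Ω → Finset (Elem α)) (t : ℕ)
    (x : ℕ → ∀ i, α i) (v : ℕ → Option ↥ℬ) (y : ℕ → Finset (Elem α)) : Set Ω :=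
  {ω | (∀ s ≤ t, X s ω = x s ∧ V s ω = v s) ∧ ∀ s < t, R s ω = y s}

/-- `(X, V, R)` is an execution of the partial resampling algorithm, on a probability space
`(Ω, P)`, with sampling probabilities `p`, bad events `ℬ`, labels `L` and hitting sets `Q`:
`X t` is the assignment before iteration `t`, `V t` is the violated set of that iteration
(`none` if the run has stopped), and `R t` is its resampled set.
The violated set is an arbitrary true bad event: the choice may depend on the whole past and on
additional randomness.  The resampled set and the new values are then drawn with the prescribed
conditional probabilities given everything that happened before. After it has stopped,
the assignment no longer changes. -/
structure IsExecution {K : ℕ} (p : Elem α → ℝ) (ℬ : Finset (Finset (Elem α))) (L : ↥ℬ → Fin K)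
    (Q : Fin K → Finset (Elem α) → ℝ) {Ω : Type*} [MeasurableSpace Ω] (P : Measure Ω)
    (X : ℕ → Ω → ∀ i, α i) (V : ℕ → Ω → Option ↥ℬ) (R : ℕ → Ω → Finset (Elem α)) : Prop where
  measurable_assignment : ∀ t x, MeasurableSet {ω | X t ω = x}
  measurable_violated : ∀ t v, MeasurableSet {ω | V t ω = v}
  measurable_resampled : ∀ t Y, MeasurableSet {ω | R t ω = Y}
  initial : ∀ x : ∀ i, α i, P {ω | X 0 ω = x} = ENNReal.ofReal (∏ i, p ⟨i, x i⟩)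
  stop_iff : ∀ t ω, V t ω = none ↔ ∀ B : ↥ℬ, ¬ Holds (X t ω) B.1
  violated_holds : ∀ t ω B, V t ω = some B → Holds (X t ω) B.1
  select : ∀ t x v y,
    P (history X V R t x v y ∩ {ω | R t ω = y t}) =
      P (history X V R t x v y) * ENNReal.ofReal (selectProb L Q (v t) (y t))
  resample : ∀ t x v y,
    P (history X V R t x v y ∩ {ω | R t ω = y t} ∩ {ω | X (t + 1) ω = x (t + 1)}) =
      P (history X V R t x v y ∩ {ω | R t ω = y t}) *
        ENNReal.ofReal (resampleProb p (x t) (y t) (x (t + 1)))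

/-- The number of iterations of a run. -/
noncomputable def numIterations {ℬ : Finset (Finset (Elem α))} {Ω : Type*}
    (V : ℕ → Ω → Option ↥ℬ) (ω : Ω) : ℕ∞ :=
  {t : ℕ | V t ω ≠ none}.encard

/-- The number of resamplings of a run: the iterations in which the resampled set is not empty,
so that at least one variable is resampled. -/
noncomputable def numResamplings {ℬ : Finset (Finset (Elem α))} {Ω : Type*}
    (V : ℕ → Ω → Option ↥ℬ) (R : ℕ → Ω → Finset (Elem α)) (ω : Ω) : ℕ∞ :=
  {t : ℕ | V t ω ≠ none ∧ (R t ω).Nonempty}.encard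

end Execution

end PRA

/-! The run is compared with witness trees. A node carries a label (k, Y) and has one slot per
variable and one slot for `⋈`. The tree of an iteration reads the run backwards: that iteration is
the root, and each earlier label becomes a leaf at a deepest free slot where its parent allows it,
or is skipped if there is none. Three facts carry the proof.

Witness tree lemma (`IsExecution.real_reaches_le`): a tree occurs with probability at most the
product of Q_k(Y) p^Y over its labels. The proof runs forwards in time and bounds the conditional
probability, given the current assignment, by `potential`: a value already drawn is not paid for
again, but it must agree with the deepest label on its variable, which is the first one to be met.
Two subsets of the same bad event always conflict, either through a variable or through `⋈`. Hence,
whichever true event B is selected, at most one Y ⊆ B can account for the last attached leaf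
(`WTree.insert_maxCand_unique`), and the selection rule does not matter.

Total weight (`sum_weight_le`): the trees with root (k, Y) weigh at most Q_k(Y) λ^Y / (1 - S_k).
These numbers satisfy the recursive inequality for tree weights: the slot for `⋈` contributes at
most 1 / (1 - S_k), the slot of a variable i in Y at most λ_i, and the factors λ_i turn p^Y into
λ^Y. Summing over nonempty roots gives at most ∑ λ_i.

Distinctness (`witness_ne`): different resamplings of one run have different trees, because an
earlier copy of the root label always finds a place, so its multiplicity grows with time.

Hence the expected number of resamplings is at most the total weight. Termination follows because an
iteration picks the empty set with conditional probability at most some q < 1, while the probability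
of a resampling at time t tends to 0. -/

namespace PRA

/-! ### Labelled trees and attachment at deepest candidates -/

/-- Rooted trees whose nodes carry a label in `ε` and have at most one child in each slot
`s : σ`. -/
inductive WTree (σ ε : Type*)
  | nil : WTree σ ε
  | node (e : ε) (ch : σ → WTree σ ε) : WTree σ ε

namespace WTree

variable {σ ε : Type*}

/-- The label at the end of a path that starts from the root. -/
def get : WTree σ ε → List σ → Option ε
  | nil, _ => none
  | node e _, [] => some e
  | node _ ch, s :: π => (ch s).get π

/-- A path at whose end a new leaf can be attached. -/
def Free : WTree σ ε → List σ → Prop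
  | nil, p => p = []
  | node _ _, [] => False
  | node _ ch, s :: π => (ch s).Free π

open Classical in
/-- Attach a new leaf at a free path. -/
noncomputable def insert (e : ε) : WTree σ ε → List σ → WTree σ ε
  | nil, _ => node e fun _ => nil
  | node f ch, [] => node f ch
  | node f ch, s :: π => node f (Function.update ch s ((ch s).insert e π))

/-- The multiset of all labels. -/
def labels [Fintype σ] : WTree σ ε → Multiset ε
  | nil => 0
  | node e ch => e ::ₘ ∑ s, (ch s).labels

/-- The number of levels. -/
def height [Fintype σ] : WTree σ ε → ℕ
  | nil => 0
  | node _ ch => 1 + Finset.univ.sup fun s => (ch s).height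

theorem Free.get_append {τ : WTree σ ε} {p : List σ} (h : τ.Free p) (q : List σ) :
    τ.get (p ++ q) = none := by
  induction τ generalizing p with
  | nil => rfl
  | node e ch ih =>
    cases p with
    | nil => exact h.elim
    | cons s π => exact ih s h

theorem Free.get_eq {τ : WTree σ ε} {p : List σ} (h : τ.Free p) : τ.get p = none := by
  simpa using h.get_append []

theorem free_concat {τ : WTree σ ε} {π : List σ} {f : ε} {s : σ} (hf : τ.get π = some f)
    (h : τ.get (π ++ [s]) = none) : τ.Free (π ++ [s]) := by
  induction τ generalizing π with
  | nil => simp [get] at hf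
  | node e ch ih =>
    cases π with
    | nil =>
      simp only [List.nil_append, get, Free] at h ⊢
      cases hc : ch s with
      | nil => rfl
      | node g c => simp [hc, get] at h
    | cons r π => exact ih r hf h

theorem get_insert {τ : WTree σ ε} {p : List σ} (e : ε) (h : τ.Free p) (q : List σ)
    [Decidable (q = p)] : (τ.insert e p).get q = if q = p then some e else τ.get q := by
  induction τ generalizing p q with
  | nil =>
    obtain rfl : p = [] := h
    cases q <;> simp [insert, get]
  | node f ch ih =>
    cases p with
    | nil => exact h.elim
    | cons s π =>
      cases q with
      | nil => simp [insert, get]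
      | cons r q =>
        classical
        by_cases hr : r = s
        · subst hr
          have := ih r (p := π) h q
          simp only [insert, get, Function.update_self, this]
          simp
        · simp [insert, get, hr]

theorem get_injective {τ τ' : WTree σ ε} (h : ∀ q, τ.get q = τ'.get q) : τ = τ' := by
  induction τ generalizing τ' with
  | nil =>
    cases τ' with
    | nil => rfl
    | node e ch => simpa [get] using h []
  | node e ch ih =>
    cases τ' with
    | nil => simpa [get] using h []
    | node e' ch' =>
      obtain rfl : e = e' := by simpa [get] using h []
      congr 1
      funext s
      exact ih s fun q => by simpa [get] using h (s :: q)

theorem get_length_lt [Fintype σ] {τ : WTree σ ε} {π : List σ} {f : ε} (h : τ.get π = some f) :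
    π.length < τ.height := by
  induction τ generalizing π with
  | nil => simp [get] at h
  | node e ch ih =>
    cases π with
    | nil => simp [height]
    | cons s π =>
      have h1 := ih s h
      have h2 := Finset.le_sup (f := fun s => (ch s).height) (Finset.mem_univ s)
      simp only [height, List.length_cons]
      omega

theorem Free.length_le [Fintype σ] {τ : WTree σ ε} {p : List σ} (h : τ.Free p) :
    p.length ≤ τ.height := by
  induction τ generalizing p with
  | nil => simp [show p = [] from h]
  | node e ch ih =>
    cases p with
    | nil => simp
    | cons s π =>
      have h1 := ih s h
      have h2 := Finset.le_sup (f := fun s => (ch s).height) (Finset.mem_univ s)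
      simp only [height, List.length_cons]
      omega

theorem labels_insert [Fintype σ] {τ : WTree σ ε} {p : List σ} (e : ε) (h : τ.Free p) :
    (τ.insert e p).labels = e ::ₘ τ.labels := by
  classical
  induction τ generalizing p with
  | nil => simp [insert, labels]
  | node f ch ih =>
    cases p with
    | nil => exact h.elim
    | cons s π =>
      simp only [insert, labels]
      rw [Multiset.cons_swap, ← Finset.add_sum_erase _ _ (Finset.mem_univ s),
        ← Finset.add_sum_erase _ (fun s => (ch s).labels) (Finset.mem_univ s)]
      simp only [Function.update_self]
      rw [ih s h, Multiset.cons_add]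
      congr 3
      refine Finset.sum_congr rfl fun r hr => ?_
      rw [Function.update_of_ne (Finset.ne_of_mem_erase hr)]

variable (A : ε → σ → ε → Prop)

/-- Every child is allowed in its slot by the label of its parent. -/
def Valid (τ : WTree σ ε) : Prop :=
  ∀ π s f g, τ.get π = some f → τ.get (π ++ [s]) = some g → A f s g

/-- The free paths at which a leaf with label `e` is allowed. -/
def Cand (τ : WTree σ ε) (e : ε) (p : List σ) : Prop :=
  τ.Free p ∧ ∀ π s, p = π ++ [s] → ∀ f, τ.get π = some f → A f s e

/-- The deepest candidates. -/
def MaxCand (τ : WTree σ ε) (e : ε) (p : List σ) : Prop :=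
  τ.Cand A e p ∧ ∀ q, τ.Cand A e q → q.length ≤ p.length

open Classical in
/-- Attach a leaf with label `e` at one of its deepest candidates, if there is any. -/
noncomputable def step (e : ε) (τ : WTree σ ε) : WTree σ ε :=
  if h : ∃ p, τ.MaxCand A e p then τ.insert e h.choose else τ

variable {A}

theorem Cand.exists_maxCand [Fintype σ] {τ : WTree σ ε} {e : ε} {p : List σ}
    (h : τ.Cand A e p) : ∃ q, τ.MaxCand A e q := by
  have hb : BddAbove {n | ∃ q, τ.Cand A e q ∧ q.length = n} := by
    refine ⟨τ.height, ?_⟩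
    rintro _ ⟨q, hq, rfl⟩
    exact hq.1.length_le
  obtain ⟨q, hq, hl⟩ := Nat.sSup_mem (s := {n | ∃ q, τ.Cand A e q ∧ q.length = n})
    ⟨_, p, h, rfl⟩ hb
  exact ⟨q, hq, fun r hr => hl ▸ le_csSup hb ⟨r, hr, rfl⟩⟩

theorem step_cases [Fintype σ] (A : ε → σ → ε → Prop) (e : ε) (τ : WTree σ ε) :
    (∃ p, τ.MaxCand A e p ∧ τ.step A e = τ.insert e p) ∨
      ((∀ p, ¬ τ.Cand A e p) ∧ τ.step A e = τ) := by
  by_cases h : ∃ p, τ.MaxCand A e p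
  · exact Or.inl ⟨h.choose, h.choose_spec, by rw [step, dif_pos h]⟩
  · exact Or.inr ⟨fun p hp => h hp.exists_maxCand, by rw [step, dif_neg h]⟩

theorem cand_concat {τ : WTree σ ε} {e f : ε} {π : List σ} {s : σ} (hf : τ.get π = some f)
    (hA : A f s e) (h : τ.get (π ++ [s]) = none) : τ.Cand A e (π ++ [s]) := by
  refine ⟨free_concat hf h, fun π' s' heq f' hf' => ?_⟩
  obtain ⟨rfl, hs⟩ := List.append_inj' heq rfl
  obtain rfl : s = s' := by simpa using hs
  rw [hf] at hf'
  cases hf'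
  exact hA

/-- If a slot remains allowed along its chain of children, the chain ends in a candidate. -/
theorem exists_cand_of_persistent [Fintype σ] {τ : WTree σ ε} (hτ : τ.Valid A) {e f : ε}
    {π : List σ} {s : σ} (hs : ∀ f g, A f s g → A f s e → A g s e) (hf : τ.get π = some f)
    (hA : A f s e) : ∃ p, τ.Cand A e p ∧ π.length < p.length := by
  -- Descend from π through slot `s` only; `n` bounds the number of levels that remain.
  obtain ⟨n, hn⟩ : ∃ n, τ.height ≤ π.length + n := ⟨τ.height, by omega⟩
  induction n generalizing π f with
  | zero =>
    have := get_length_lt hf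
    omega
  | succ n ih =>
    cases hg : τ.get (π ++ [s]) with
    | none => exact ⟨_, cand_concat hf hA hg, by simp⟩
    | some g =>
      obtain ⟨p, hp, hl⟩ := ih hg (hs f g (hτ _ _ _ _ hf hg) hA) (by simp; omega)
      refine ⟨p, hp, ?_⟩
      simp at hl
      omega

theorem Valid.insert {τ : WTree σ ε} (hτ : τ.Valid A) {e : ε} {p : List σ}
    (hp : τ.Cand A e p) : (τ.insert e p).Valid A := by
  classical
  intro π s f g hf hg
  rw [get_insert e hp.1] at hf hg
  split_ifs at hg with h1
  · rw [if_neg (by rintro rfl; simp at h1)] at hf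
    cases hg
    exact hp.2 π s h1.symm f hf
  · split_ifs at hf with h2
    · subst h2
      rw [hp.1.get_append] at hg
      cases hg
    · exact hτ _ _ _ _ hf hg

theorem Valid.step [Fintype σ] {τ : WTree σ ε} (hτ : τ.Valid A) (e : ε) :
    (τ.step A e).Valid A := by
  rcases step_cases A e τ with ⟨p, hp, h⟩ | ⟨-, h⟩
  · rw [h]
    exact hτ.insert hp.1
  · rwa [h]

theorem valid_nil : (nil : WTree σ ε).Valid A := fun _ _ _ _ h => by simp [get] at h

/-- Two conflicting labels cannot both have been attached last. -/
theorem insert_maxCand_unique {τ₁ τ₂ : WTree σ ε} {e₁ e₂ : ε} {p₁ p₂ : List σ}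
    (h₁ : τ₁.MaxCand A e₁ p₁) (h₂ : τ₂.MaxCand A e₂ p₂)
    (heq : τ₁.insert e₁ p₁ = τ₂.insert e₂ p₂) (h12 : ∃ s, A e₁ s e₂) (h21 : ∃ s, A e₂ s e₁) :
    e₁ = e₂ ∧ τ₁ = τ₂ := by
  classical
  -- If the paths differ, `e₂` is already a leaf of `τ₁`, and `e₁` could have been attached below
  -- it. So the maximal path `p₁` is strictly deeper than `p₂`; the symmetric statement then gives a
  -- contradiction.
  have key : ∀ {τ₁ τ₂ : WTree σ ε} {e₁ e₂ : ε} {p₁ p₂ : List σ}, τ₁.MaxCand A e₁ p₁ →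
      τ₂.MaxCand A e₂ p₂ → τ₁.insert e₁ p₁ = τ₂.insert e₂ p₂ → (∃ s, A e₂ s e₁) → p₁ ≠ p₂ →
      p₂.length < p₁.length := by
    intro τ₁ τ₂ e₁ e₂ p₁ p₂ h₁ h₂ heq ⟨s, hs⟩ hne
    have g1 : τ₁.get p₂ = some e₂ := by
      have := congrArg (fun τ => τ.get p₂) heq
      simpa [get_insert _ h₁.1.1, get_insert _ h₂.1.1, hne.symm] using this
    have g2 : τ₁.get (p₂ ++ [s]) = none := by
      have := congrArg (fun τ => τ.get (p₂ ++ [s])) heq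
      simp only [get_insert _ h₁.1.1, get_insert _ h₂.1.1, h₂.1.1.get_append] at this
      by_cases h : p₂ ++ [s] = p₁
      · simp [h] at this
        simp [this] at h
      · simpa [h] using this
    have := h₁.2 _ (cand_concat g1 hs g2)
    simp at this
    omega
  by_cases hp : p₁ = p₂
  · subst hp
    refine ⟨?_, get_injective fun q => ?_⟩
    · have := congrArg (fun τ => τ.get p₁) heq
      simpa [get_insert _ h₁.1.1, get_insert _ h₂.1.1] using this
    · by_cases hq : q = p₁
      · rw [hq, h₁.1.1.get_eq, h₂.1.1.get_eq]
      · have := congrArg (fun τ => τ.get q) heq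
        simpa [get_insert _ h₁.1.1, get_insert _ h₂.1.1, hq] using this
  · have := key h₁ h₂ heq h21 hp
    have := key h₂ h₁ heq.symm h12 (Ne.symm hp)
    omega

/-- A label that conflicts with the last attached leaf has a candidate. -/
theorem exists_cand_insert {τ : WTree σ ε} {e e' : ε} {p : List σ} (h : τ.Free p)
    (hA : ∃ s, A e s e') : ∃ q, (τ.insert e p).Cand A e' q := by
  classical
  obtain ⟨s, hs⟩ := hA
  refine ⟨p ++ [s], cand_concat (f := e) ?_ hs ?_⟩
  · simp [get_insert e h]
  · simp [get_insert e h, h.get_append]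

end WTree

/-! ### Weights of trees and their recursion -/

namespace WTree

variable {σ ε : Type*} [Fintype σ]

/-- The product of the weights of all labels. -/
def weight (w : ε → ℝ) (τ : WTree σ ε) : ℝ := (τ.labels.map w).prod

@[simp] theorem weight_nil (w : ε → ℝ) : (nil : WTree σ ε).weight w = 1 := by
  simp [weight, labels]

theorem weight_node (w : ε → ℝ) (e : ε) (ch : σ → WTree σ ε) :
    (node e ch).weight w = w e * ∏ s, (ch s).weight w := by
  have h : ∀ S : Finset σ, ((∑ s ∈ S, (ch s).labels).map w).prod = ∏ s ∈ S, (ch s).weight w := by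
    classical
    intro S
    induction S using Finset.induction_on with
    | empty => simp
    | insert a S ha ih => rw [Finset.sum_insert ha, Finset.prod_insert ha, Multiset.map_add,
        Multiset.prod_add, ih, weight]
  simp [weight, labels, h]

theorem weight_insert (w : ε → ℝ) {τ : WTree σ ε} {p : List σ} (e : ε) (h : τ.Free p) :
    (τ.insert e p).weight w = w e * τ.weight w := by
  simp [weight, labels_insert e h]

theorem weight_nonneg {w : ε → ℝ} (hw : ∀ e, 0 ≤ w e) (τ : WTree σ ε) : 0 ≤ τ.weight w :=
  Multiset.prod_nonneg (by simp only [Multiset.mem_map]; rintro _ ⟨e, -, rfl⟩; exact hw e)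

variable [Fintype ε]

open Classical in
/-- The valid trees with a given root label and at most `n` levels. -/
noncomputable def validTrees (A : ε → σ → ε → Prop) : ℕ → ε → Finset (WTree σ ε)
  | 0, _ => ∅
  | n + 1, f => (Fintype.piFinset fun s =>
      Insert.insert nil ((Finset.univ.filter (A f s)).biUnion (validTrees A n))).image (node f)

theorem mem_validTrees {A : ε → σ → ε → Prop} {n : ℕ} {f : ε} {ch : σ → WTree σ ε}
    (hτ : (node f ch).Valid A) (hn : (node f ch).height ≤ n) :
    node f ch ∈ validTrees A n f := by
  classical
  induction n generalizing f ch with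
  | zero => simp [height] at hn
  | succ n ih =>
    simp only [validTrees, Finset.mem_image, Fintype.mem_piFinset]
    refine ⟨ch, fun s => ?_, rfl⟩
    have hs : (ch s).Valid A := fun π r f' g hf hg => hτ (s :: π) r f' g hf hg
    have hl : (ch s).height ≤ n := by
      have := Finset.le_sup (f := fun s => (ch s).height) (Finset.mem_univ s)
      simp only [height] at hn
      omega
    cases hc : ch s with
    | nil => simp
    | node g c =>
      rw [hc] at hs hl
      refine Finset.mem_insert_of_mem (Finset.mem_biUnion.2 ⟨g, ?_, ih hs hl⟩)
      simpa using hτ [] s f g rfl (by simp [get, hc])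

theorem exists_of_mem_validTrees {A : ε → σ → ε → Prop} {n : ℕ} {f : ε} {τ : WTree σ ε}
    (h : τ ∈ validTrees A n f) : ∃ ch, τ = node f ch := by
  classical
  cases n with
  | zero => simp [validTrees] at h
  | succ n =>
    obtain ⟨ch, -, rfl⟩ := Finset.mem_image.1 h
    exact ⟨ch, rfl⟩

open Classical in
/-- The total weight of valid trees is bounded by any solution of the recursive inequality. -/
theorem sum_weight_validTrees_le {A : ε → σ → ε → Prop} {w T : ε → ℝ} (hw : ∀ e, 0 ≤ w e)
    (hT : ∀ e, 0 ≤ T e)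
    (h : ∀ f, w f * ∏ s, (1 + ∑ g with A f s g, T g) ≤ T f)
    (n : ℕ) (f : ε) : ∑ τ ∈ validTrees A n f, τ.weight w ≤ T f := by
  induction n generalizing f with
  | zero => simpa [validTrees] using hT f
  | succ n ih =>
    rw [validTrees, Finset.sum_image fun a _ b _ hab => by simpa using hab]
    simp only [weight_node]
    -- The subtrees in different slots are chosen independently, so the sum factors over slots. An
    -- empty slot (`nil`) supplies the summand 1.
    rw [← Finset.mul_sum, ← Finset.prod_univ_sum (fun s => Insert.insert nil
      ((Finset.univ.filter (A f s)).biUnion (validTrees A n))) fun _ τ => τ.weight w]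
    refine le_trans (mul_le_mul_of_nonneg_left (Finset.prod_le_prod
      (fun s _ => Finset.sum_nonneg fun τ _ => weight_nonneg hw τ) fun s _ => ?_) (hw f)) (h f)
    rw [Finset.sum_insert, weight_nil, Finset.sum_biUnion]
    · gcongr with g _
      exact ih g
    · intro g _ g' _ hne
      refine Finset.disjoint_left.2 fun τ h1 h2 => hne ?_
      obtain ⟨c, rfl⟩ := exists_of_mem_validTrees h1
      obtain ⟨c', h'⟩ := exists_of_mem_validTrees h2
      cases h'
      rfl
    · intro hm
      obtain ⟨g, -, hg⟩ := Finset.mem_biUnion.1 hm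
      obtain ⟨c, hc⟩ := exists_of_mem_validTrees hg
      cases hc

end WTree
-- The condition on λ bounds the total weight of trees
theorem setPow_nonneg {ι : Type*} {α : ι → Type*} {v : Elem α → ℝ}
    (hv : ∀ e, 0 ≤ v e) (Y : Finset (Elem α)) : 0 ≤ setPow v Y :=
  Finset.prod_nonneg fun e _ => hv e

theorem term_nonneg {ι : Type*} {α : ι → Type*} {K : ℕ}
    {Q : Fin K → Finset (Elem α) → ℝ} {lam : Elem α → ℝ}
    (hQ : ∀ k Y, 0 ≤ Q k Y) (hlam : ∀ e, 0 ≤ lam e) (k : Fin K) (Y : Finset (Elem α)) :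
    0 ≤ Q k Y * setPow lam Y :=
  mul_nonneg (hQ k Y) (setPow_nonneg hlam Y)

section Condition

variable {ι : Type*} [Fintype ι] {α : ι → Type*} [∀ i, Fintype (α i)] {K : ℕ}
  {ℬ : Finset (Finset (Elem α))}

/-- The labels of witness trees: a resampled set together with the label of the violated set. -/
abbrev Event (α : ι → Type*) (K : ℕ) := Fin K × Finset (Elem α)

/-- The slots of a node are the variables that it involves and one additional slot for the
relation `⋈`. -/
def Allowed (L : ↥ℬ → Fin K) (f : Event α K) : Option ι → Event α K → Prop
  | some i, e => Involves i f.2 ∧ Involves i e.2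
  | none, e => f.1 = e.1 ∧ Bowtie L f.1 e.2 f.2

open Classical in
theorem sum_bowtie_le_Smax (L : ↥ℬ → Fin K) (Q : Fin K → Finset (Elem α) → ℝ)
    (lam : Elem α → ℝ) {k : Fin K} {Y : Finset (Elem α)} (h : 0 < Q k Y) :
    ∑ Y' : Finset (Elem α) with Bowtie L k Y' Y, Q k Y' * setPow lam Y' ≤ Smax L Q lam k :=
  le_ciSup (f := fun Y : {Y : Finset (Elem α) // 0 < Q k Y} =>
    ∑ Y' : Finset (Elem α) with Bowtie L k Y' Y.1, Q k Y' * setPow lam Y')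
    (Set.finite_range _).bddAbove ⟨Y, h⟩

theorem Smax_nonneg (L : ↥ℬ → Fin K) {Q : Fin K → Finset (Elem α) → ℝ} {lam : Elem α → ℝ}
    (hQ : ∀ k Y, 0 ≤ Q k Y) (hlam : ∀ e, 0 ≤ lam e) (k : Fin K) : 0 ≤ Smax L Q lam k := by
  classical
  exact Real.iSup_nonneg fun _ => Finset.sum_nonneg fun Y _ => term_nonneg hQ hlam k Y

theorem Gvar_nonneg {Q : Fin K → Finset (Elem α) → ℝ} {lam : Elem α → ℝ}
    (hQ : ∀ k Y, 0 ≤ Q k Y) (hlam : ∀ e, 0 ≤ lam e) (k : Fin K) (i : ι) :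
    0 ≤ Gvar (Q k) lam i :=
  Finset.sum_nonneg fun Y _ => term_nonneg hQ hlam k Y

theorem Smax_le_Gtot (L : ↥ℬ → Fin K) {Q : Fin K → Finset (Elem α) → ℝ} {lam : Elem α → ℝ}
    (hQ : ∀ k Y, 0 ≤ Q k Y) (hlam : ∀ e, 0 ≤ lam e) (k : Fin K) :
    Smax L Q lam k ≤ Gtot (Q k) lam := by
  classical
  exact Real.iSup_le (fun _ => Finset.sum_le_sum_of_subset_of_nonneg (Finset.filter_subset _ _)
    fun Y _ _ => term_nonneg hQ hlam k Y) (Finset.sum_nonneg fun Y _ => term_nonneg hQ hlam k Y)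

theorem Smax_le_zero (L : ↥ℬ → Fin K) {Q : Fin K → Finset (Elem α) → ℝ} (lam : Elem α → ℝ)
    (hQ : ∀ k Y, 0 ≤ Q k Y) (k : Fin K)
    (h : ∀ Y Y', 0 < Q k Y → 0 < Q k Y' → ¬ Bowtie L k Y Y') : Smax L Q lam k ≤ 0 := by
  classical
  refine Real.iSup_le (fun Y => (Finset.sum_eq_zero fun Y' hY' => ?_).le) le_rfl
  rcases (hQ k Y').eq_or_lt with h0 | h0
  · simp [← h0]
  · exact absurd (Finset.mem_filter.1 hY').2 (h Y' Y.1 h0 Y.2)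

/-- The required bound on λ_i increases with the number subtracted from 1, so any upper bound `b`
for S_k that is below 1 leads to condition (a). With `b` equal to G it covers (b), with `b` equal to
0 it covers (c). -/
theorem le_Smax_of_bound {Q : Fin K → Finset (Elem α) → ℝ} {lam : Elem α → ℝ}
    (hQ : ∀ k Y, 0 ≤ Q k Y) (hlam : ∀ e, 0 ≤ lam e) {L : ↥ℬ → Fin K} {b : Fin K → ℝ}
    (hb : ∀ k, b k < 1) (hle : ∀ k, Smax L Q lam k ≤ b k)
    (h : ∀ i, 1 + ∑ k, Gvar (Q k) lam i / (1 - b k) ≤ rowSum lam i) :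
    (∀ k, Smax L Q lam k < 1) ∧
      ∀ i, 1 + ∑ k, Gvar (Q k) lam i / (1 - Smax L Q lam k) ≤ rowSum lam i := by
  refine ⟨fun k => (hle k).trans_lt (hb k), fun i => le_trans ?_ (h i)⟩
  gcongr with k
  · exact Gvar_nonneg hQ hlam k i
  · linarith [hb k]
  · exact hle k

/-- The empty set is chosen with probability less than one. -/
theorem empty_le_Smax {Q : Fin K → Finset (Elem α) → ℝ} {lam : Elem α → ℝ}
    (hQ : ∀ k Y, 0 ≤ Q k Y) (hlam : ∀ e, 0 ≤ lam e) (L : ↥ℬ → Fin K) (B : ↥ℬ) :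
    Q (L B) ∅ ≤ Smax L Q lam (L B) := by
  classical
  rcases (hQ (L B) ∅).eq_or_lt with h0 | h0
  · rw [← h0]
    exact Smax_nonneg L hQ hlam _
  · refine le_trans ?_ (sum_bowtie_le_Smax L Q lam h0)
    -- The empty set shares no variable with itself and lies in B, so ∅ `⋈` ∅, and its own term Q(∅)
    -- λ^∅ = Q(∅) appears in the sum.
    have hm : (∅ : Finset (Elem α)) ∈ Finset.univ.filter fun Y' => Bowtie L (L B) Y' ∅ := by
      simp only [Finset.mem_filter, Finset.mem_univ, true_and]
      exact ⟨by simp [Overlap, Involves], B, rfl, by simp, by simp⟩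
    have := Finset.single_le_sum (f := fun Y' => Q (L B) Y' * setPow lam Y')
      (fun Y _ => term_nonneg hQ hlam (L B) Y) hm
    simpa [setPow] using this

/-- The bound on the total weight of the witness trees with a given root. -/
noncomputable def rootBound (L : ↥ℬ → Fin K) (Q : Fin K → Finset (Elem α) → ℝ)
    (lam : Elem α → ℝ) (f : Event α K) : ℝ :=
  Q f.1 f.2 * setPow lam f.2 / (1 - Smax L Q lam f.1)

theorem rootBound_nonneg {L : ↥ℬ → Fin K} {Q : Fin K → Finset (Elem α) → ℝ} {lam : Elem α → ℝ}
    (hQ : ∀ k Y, 0 ≤ Q k Y) (hlam : ∀ e, 0 ≤ lam e) (hS : ∀ k, Smax L Q lam k < 1)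
    (f : Event α K) : 0 ≤ rootBound L Q lam f :=
  div_nonneg (term_nonneg hQ hlam _ _) (sub_nonneg.2 (hS _).le)

open Classical in
theorem sum_rootBound_involves (L : ↥ℬ → Fin K) (Q : Fin K → Finset (Elem α) → ℝ)
    (lam : Elem α → ℝ) (i : ι) : ∑ f : Event α K with Involves i f.2, rootBound L Q lam f =
      ∑ k, Gvar (Q k) lam i / (1 - Smax L Q lam k) := by
  rw [Finset.sum_filter, Fintype.sum_prod_type]
  refine Finset.sum_congr rfl fun k _ => ?_
  rw [← Finset.sum_filter, Gvar, Finset.sum_div]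
  rfl

/-- Each involved variable cancels one denominator λ_i of p^Y. Since Y may contain several elements
of the same variable, denominators may be left over; they only help, because λ_i ≥ 1. -/
theorem prod_rowSum_mul_setPow_le {lam : Elem α → ℝ} (hlam : ∀ e, 0 ≤ lam e)
    (h1 : ∀ i, 1 ≤ rowSum lam i) (Y : Finset (Elem α)) [∀ i, Decidable (Involves i Y)] :
    setPow (fun e => lam e / rowSum lam e.1) Y *
      ∏ i, (if Involves i Y then rowSum lam i else 1) ≤ setPow lam Y := by
  classical
  have h0 : 0 < ∏ e ∈ Y, rowSum lam e.1 :=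
    Finset.prod_pos fun e _ => one_pos.trans_le (h1 e.1)
  have : ∏ i, (if Involves i Y then rowSum lam i else 1) ≤ ∏ e ∈ Y, rowSum lam e.1 := by
    rw [← Finset.prod_fiberwise' Y (fun e => e.1) (rowSum lam)]
    refine Finset.prod_le_prod (fun i _ => ?_) fun i _ => ?_
    · split_ifs
      exacts [zero_le_one.trans (h1 i), zero_le_one]
    · rw [Finset.prod_const]
      split_ifs with h
      · obtain ⟨j, hj⟩ := h
        refine le_self_pow₀ (h1 i) (Finset.card_pos.2 ⟨⟨i, j⟩, ?_⟩).ne'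
        simp [hj]
      · exact one_le_pow₀ (h1 i)
  rw [setPow, Finset.prod_div_distrib, div_mul_eq_mul_div, div_le_iff₀ h0]
  exact mul_le_mul_of_nonneg_left this (setPow_nonneg hlam Y)

/-- The weight of a label in a witness tree. -/
noncomputable def eventWeight (Q : Fin K → Finset (Elem α) → ℝ) (p : Elem α → ℝ)
    (f : Event α K) : ℝ :=
  Q f.1 f.2 * setPow p f.2

-- The recursive inequality for `rootBound`: the slot for `⋈` gives at most 1 + S/(1 - S) = 1/(1 -
-- S), a variable of Y gives at most λ_i by the condition, every other slot gives 1.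
open Classical in
theorem eventWeight_mul_prod_le {L : ↥ℬ → Fin K} {Q : Fin K → Finset (Elem α) → ℝ}
    {lam : Elem α → ℝ} (hQ : ∀ k Y, 0 ≤ Q k Y) (hlam : ∀ e, 0 ≤ lam e)
    (hS : ∀ k, Smax L Q lam k < 1)
    (hrow : ∀ i, 1 + ∑ k, Gvar (Q k) lam i / (1 - Smax L Q lam k) ≤ rowSum lam i)
    (h1 : ∀ i, 1 ≤ rowSum lam i) (f : Event α K) :
    eventWeight Q (fun e => lam e / rowSum lam e.1) f *
      ∏ s, (1 + ∑ g with Allowed L f s g, rootBound L Q lam g) ≤ rootBound L Q lam f := by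
  obtain ⟨k, Y⟩ := f
  have hT := rootBound_nonneg (L := L) hQ hlam hS
  have hk : 0 < 1 - Smax L Q lam k := sub_pos.2 (hS k)
  rcases (hQ k Y).eq_or_lt with h0 | h0
  · simpa [eventWeight, ← h0] using hT _
  rw [Fintype.prod_option]
  have hnone : 1 + ∑ g with Allowed L (k, Y) none g, rootBound L Q lam g ≤
      1 / (1 - Smax L Q lam k) := by
    have : ∑ g with Allowed L (k, Y) none g, rootBound L Q lam g =
        (∑ Y' with Bowtie L k Y' Y, Q k Y' * setPow lam Y') / (1 - Smax L Q lam k) := by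
      rw [Finset.sum_filter, Fintype.sum_prod_type, Finset.sum_eq_single k]
      · rw [← Finset.sum_filter, Finset.sum_div]
        refine Finset.sum_congr (by ext; simp [Allowed]) fun _ _ => rfl
      · intro b _ hb
        refine Finset.sum_eq_zero fun Y' _ => if_neg fun h => hb h.1.symm
      · simp
    rw [this, ← sub_nonneg]
    have hb := sum_bowtie_le_Smax L Q lam h0
    have e : 1 / (1 - Smax L Q lam k) - (1 + (∑ Y' with Bowtie L k Y' Y, Q k Y' * setPow lam Y') /
        (1 - Smax L Q lam k)) = (Smax L Q lam k - ∑ Y' with Bowtie L k Y' Y,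
          Q k Y' * setPow lam Y') / (1 - Smax L Q lam k) := by
      field_simp
      ring
    rw [e]
    exact div_nonneg (sub_nonneg.2 hb) hk.le
  have hsome : ∀ i, 1 + ∑ g with Allowed L (k, Y) (some i) g, rootBound L Q lam g ≤
      if Involves i Y then rowSum lam i else 1 := by
    intro i
    split_ifs with h
    · refine le_trans (le_of_eq ?_) (hrow i)
      rw [← sum_rootBound_involves]
      congr 1
      exact Finset.sum_congr (by ext; simp [Allowed, h]) fun _ _ => rfl
    · simp [Allowed, h]
  have hpos : ∀ s, 0 ≤ 1 + ∑ g with Allowed L (k, Y) s g, rootBound L Q lam g := fun s =>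
    add_nonneg zero_le_one (Finset.sum_nonneg fun g _ => hT g)
  have hp : ∀ e : Elem α, 0 ≤ lam e / rowSum lam e.1 := fun e =>
    div_nonneg (hlam e) (zero_le_one.trans (h1 e.1))
  calc _ ≤ Q k Y * setPow (fun e => lam e / rowSum lam e.1) Y *
        (1 / (1 - Smax L Q lam k) * ∏ i, if Involves i Y then rowSum lam i else 1) := by
        refine mul_le_mul_of_nonneg_left (mul_le_mul hnone (Finset.prod_le_prod
          (fun i _ => hpos _) fun i _ => hsome i) (Finset.prod_nonneg fun i _ => hpos _)
          (one_div_nonneg.2 hk.le)) (term_nonneg hQ hp k Y)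
    _ = Q k Y * (setPow (fun e => lam e / rowSum lam e.1) Y *
        ∏ i, if Involves i Y then rowSum lam i else 1) / (1 - Smax L Q lam k) := by ring
    _ ≤ _ := by
        refine div_le_div_of_nonneg_right (mul_le_mul_of_nonneg_left
          (prod_rowSum_mul_setPow_le hlam h1 Y) h0.le) hk.le

-- A nonempty set involves some variable, so a union bound over variables applies; the condition
-- bounds the share of variable i even by λ_i - 1.
open Classical in
theorem sum_rootBound_nonempty_le {L : ↥ℬ → Fin K} {Q : Fin K → Finset (Elem α) → ℝ}
    {lam : Elem α → ℝ} (hQ : ∀ k Y, 0 ≤ Q k Y) (hlam : ∀ e, 0 ≤ lam e)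
    (hS : ∀ k, Smax L Q lam k < 1)
    (hrow : ∀ i, 1 + ∑ k, Gvar (Q k) lam i / (1 - Smax L Q lam k) ≤ rowSum lam i) :
    ∑ f : Event α K with f.2.Nonempty, rootBound L Q lam f ≤ ∑ i, rowSum lam i := by
  have hT := rootBound_nonneg (L := L) hQ hlam hS
  calc _ ≤ ∑ f : Event α K, ∑ i, if Involves i f.2 then rootBound L Q lam f else 0 := by
        rw [Finset.sum_filter]
        refine Finset.sum_le_sum fun f _ => ?_
        have h0 : ∀ i, 0 ≤ if Involves i f.2 then rootBound L Q lam f else 0 := fun i => by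
          split_ifs
          exacts [hT f, le_rfl]
        split_ifs with h
        · obtain ⟨⟨i, j⟩, hij⟩ := h
          refine le_trans (le_of_eq ?_) (Finset.single_le_sum (fun i _ => h0 i)
            (Finset.mem_univ i))
          exact (if_pos ⟨j, hij⟩).symm
        · exact Finset.sum_nonneg fun i _ => h0 i
    _ = ∑ i, ∑ f : Event α K with Involves i f.2, rootBound L Q lam f := by
        simp_rw [Finset.sum_filter]
        rw [Finset.sum_comm]
    _ ≤ _ := by
        refine Finset.sum_le_sum fun i _ => ?_
        rw [sum_rootBound_involves]
        linarith [hrow i]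

open Classical in
/-- The total weight of any finite set of witness trees whose roots are nonempty sets. -/
theorem sum_weight_le {L : ↥ℬ → Fin K} {Q : Fin K → Finset (Elem α) → ℝ}
    {lam : Elem α → ℝ} (hQ : ∀ k Y, 0 ≤ Q k Y) (hlam : ∀ e, 0 ≤ lam e)
    (hS : ∀ k, Smax L Q lam k < 1)
    (hrow : ∀ i, 1 + ∑ k, Gvar (Q k) lam i / (1 - Smax L Q lam k) ≤ rowSum lam i)
    (h1 : ∀ i, 1 ≤ rowSum lam i) (S : Finset (WTree (Option ι) (Event α K)))
    (hS' : ∀ τ ∈ S, τ.Valid (Allowed L) ∧ ∃ f, τ.get [] = some f ∧ f.2.Nonempty) :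
    ∑ τ ∈ S, τ.weight (eventWeight Q fun e => lam e / rowSum lam e.1) ≤
      ∑ i, rowSum lam i := by
  have hw : ∀ f : Event α K, 0 ≤ eventWeight Q (fun e => lam e / rowSum lam e.1) f := fun f =>
    term_nonneg hQ (fun e => div_nonneg (hlam e) (zero_le_one.trans (h1 e.1))) f.1 f.2
  have hT := rootBound_nonneg (L := L) hQ hlam hS
  -- Finitely many trees have bounded height, so they all lie in the truncated families, to which
  -- the recursion applies.
  have hsub : S ⊆ (Finset.univ.filter fun f : Event α K => f.2.Nonempty).biUnion
      (WTree.validTrees (Allowed L) (S.sup WTree.height)) := by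
    intro τ hτ
    obtain ⟨hv, f, hf, hne⟩ := hS' τ hτ
    refine Finset.mem_biUnion.2 ⟨f, by simpa using hne, ?_⟩
    cases τ with
    | nil => simp [WTree.get] at hf
    | node e ch =>
      obtain rfl : e = f := by simpa [WTree.get] using hf
      exact WTree.mem_validTrees hv (Finset.le_sup (f := WTree.height) hτ)
  refine (Finset.sum_le_sum_of_subset_of_nonneg hsub
    fun τ _ _ => WTree.weight_nonneg hw τ).trans ?_
  rw [Finset.sum_biUnion]
  · exact (Finset.sum_le_sum fun f _ => WTree.sum_weight_validTrees_le hw hT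
      (eventWeight_mul_prod_le hQ hlam hS hrow h1) _ f).trans
      (sum_rootBound_nonempty_le hQ hlam hS hrow)
  · intro g _ g' _ hne
    refine Finset.disjoint_left.2 fun τ h1 h2 => hne ?_
    obtain ⟨c, rfl⟩ := WTree.exists_of_mem_validTrees h1
    obtain ⟨c', h'⟩ := WTree.exists_of_mem_validTrees h2
    cases h'
    rfl

end Condition

/-! ### The potential of a tree at an assignment -/

section Potential

variable {ι : Type*} {α : ι → Type*} {K : ℕ}

/-- The variable `i` is involved in some label of the tree. -/
def Occurs (τ : WTree (Option ι) (Event α K)) (i : ι) : Prop :=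
  ∃ π f, τ.get π = some f ∧ Involves i f.2

/-- A deepest label that involves the variable `i` prescribes the value `j`. -/
def Demands (τ : WTree (Option ι) (Event α K)) (i : ι) (j : α i) : Prop :=
  ∃ π f, τ.get π = some f ∧ ⟨i, j⟩ ∈ f.2 ∧
    ∀ π' f', τ.get π' = some f' → Involves i f'.2 → π'.length ≤ π.length

open Classical in
/-- The factor of the variable `i` in the potential of a tree, at the value `a`. -/
noncomputable def cost (p : Elem α → ℝ) (τ : WTree (Option ι) (Event α K)) (i : ι) (a : α i) :
    ℝ :=
  if Occurs τ i then if ∀ j, Demands τ i j → a = j then (p ⟨i, a⟩)⁻¹ else 0 else 1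

theorem cost_nonneg {p : Elem α → ℝ} (hp : ∀ e, 0 ≤ p e) (τ : WTree (Option ι) (Event α K))
    (i : ι) (a : α i) : 0 ≤ cost p τ i a := by
  unfold cost
  split_ifs
  exacts [inv_nonneg.2 (hp _), le_rfl, zero_le_one]

theorem cost_of_not_occurs (p : Elem α → ℝ) {τ : WTree (Option ι) (Event α K)} {i : ι}
    (h : ¬ Occurs τ i) (a : α i) : cost p τ i a = 1 := if_neg h

theorem not_occurs_nil (i : ι) : ¬ Occurs (.nil : WTree (Option ι) (Event α K)) i := by
  rintro ⟨π, f, h, -⟩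
  simp [WTree.get] at h

section Choice

variable {ℬ : Finset (Finset (Elem α))} {L : ↥ℬ → Fin K} {Q : Fin K → Finset (Elem α) → ℝ}

theorem eventWeight_nonneg {p : Elem α → ℝ}
    (hQ : ∀ k Y, 0 ≤ Q k Y) (hp : ∀ e, 0 ≤ p e) (f : Event α K) : 0 ≤ eventWeight Q p f :=
  term_nonneg hQ hp f.1 f.2

/-- Two sets that may be chosen for the same violated set conflict. -/
theorem exists_allowed {B : ↥ℬ} {Y Y' : Finset (Elem α)} (h : Y ⊆ B.1)
    (h' : Y' ⊆ B.1) : ∃ s, Allowed L (L B, Y) s (L B, Y') := by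
  by_cases ho : Overlap Y Y'
  · obtain ⟨i, hi⟩ := ho
    exact ⟨some i, hi⟩
  · exact ⟨none, rfl, fun ⟨i, h1, h2⟩ => ho ⟨i, h2, h1⟩, B, rfl, h', h⟩

theorem one_le_sum_powerset (hQ : ∀ k, IsFracHittingSet (Q k) (labelClass L k)) (B : ↥ℬ) :
    1 ≤ ∑ Y ∈ B.1.powerset, Q (L B) Y :=
  (hQ (L B)).hits B.1 ⟨B.2, rfl⟩

theorem selectProb_nonneg (hQ : ∀ k Y, 0 ≤ Q k Y) (v : Option ↥ℬ) (Y : Finset (Elem α)) :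
    0 ≤ selectProb L Q v Y := by
  cases v with
  | none =>
    simp only [selectProb]
    split_ifs <;> simp
  | some B =>
    simp only [selectProb]
    split_ifs
    · exact div_nonneg (hQ _ _) (Finset.sum_nonneg fun Y _ => hQ _ Y)
    · rfl

/-- The hitting property makes the normalizing denominator at least 1. -/
theorem selectProb_le (hQ : ∀ k, IsFracHittingSet (Q k) (labelClass L k)) (B : ↥ℬ)
    (Y : Finset (Elem α)) : selectProb L Q (some B) Y ≤ Q (L B) Y := by
  simp only [selectProb]
  split_ifs
  · exact div_le_self ((hQ _).nonneg Y) (one_le_sum_powerset hQ B)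
  · exact (hQ _).nonneg Y

end Choice

theorem cost_insert_of_not_involves (p : Elem α → ℝ) {τ : WTree (Option ι) (Event α K)}
    {e : Event α K} {π : List (Option ι)} (hπ : τ.Free π) {i : ι} (hi : ¬ Involves i e.2)
    (a : α i) : cost p (τ.insert e π) i a = cost p τ i a := by
  classical
  have key : ∀ q f, Involves i f.2 → ((τ.insert e π).get q = some f ↔ τ.get q = some f) := by
    intro q f hf
    rw [WTree.get_insert e hπ]
    split_ifs with h
    · rw [h, hπ.get_eq]
      refine iff_of_false (fun h => hi ?_) (by simp)
      cases h
      exact hf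
    · rfl
  have ho : Occurs (τ.insert e π) i ↔ Occurs τ i :=
    ⟨fun ⟨q, f, h, hf⟩ => ⟨q, f, (key q f hf).1 h, hf⟩,
      fun ⟨q, f, h, hf⟩ => ⟨q, f, (key q f hf).2 h, hf⟩⟩
  have hd : ∀ j, Demands (τ.insert e π) i j ↔ Demands τ i j := fun j =>
    ⟨fun ⟨q, f, h, hf, hm⟩ => ⟨q, f, (key q f ⟨j, hf⟩).1 h, hf, fun q' f' h' hf' =>
        hm q' f' ((key q' f' hf').2 h') hf'⟩,
      fun ⟨q, f, h, hf, hm⟩ => ⟨q, f, (key q f ⟨j, hf⟩).2 h, hf, fun q' f' h' hf' =>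
        hm q' f' ((key q' f' hf').1 h') hf'⟩⟩
  simp only [cost, ho, hd]

variable [Fintype ι]

theorem Occurs.exists_demands {τ : WTree (Option ι) (Event α K)} {i : ι}
    (h : Occurs τ i) : ∃ j, Demands τ i j := by
  have hb : BddAbove {n | ∃ π f, τ.get π = some f ∧ Involves i f.2 ∧ π.length = n} := by
    refine ⟨τ.height, ?_⟩
    rintro _ ⟨π, f, hf, -, rfl⟩
    exact (WTree.get_length_lt hf).le
  obtain ⟨π, f, hf, hi⟩ := h
  obtain ⟨π', f', hf', ⟨j, hj⟩, hl⟩ := Nat.sSup_mem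
    (s := {n | ∃ π f, τ.get π = some f ∧ Involves i f.2 ∧ π.length = n}) ⟨_, π, f, hf, hi, rfl⟩ hb
  exact ⟨j, π', f', hf', hj, fun π'' f'' h1 h2 => hl ▸ le_csSup hb ⟨π'', f'', h1, h2, rfl⟩⟩

/-- If i occurs, some value j is demanded and only a = j survives, contributing p · p⁻¹, which is 1,
or 0 when p vanishes. -/
theorem sum_mul_cost_le [∀ i, Fintype (α i)] {p : Elem α → ℝ}
    (hp1 : ∀ i, ∑ a, p ⟨i, a⟩ = 1) (τ : WTree (Option ι) (Event α K)) (i : ι) :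
    ∑ a, p ⟨i, a⟩ * cost p τ i a ≤ 1 := by
  classical
  by_cases h : Occurs τ i
  · obtain ⟨j, hj⟩ := h.exists_demands
    rw [Finset.sum_eq_single j]
    · rw [cost, if_pos h]
      split_ifs
      · exact mul_inv_le_one
      · simp
    · intro a _ ha
      rw [cost, if_pos h, if_neg fun h' => ha (h' j hj), mul_zero]
    · simp
  · simp [cost_of_not_occurs p h, hp1]

variable {ℬ : Finset (Finset (Elem α))}

/-- A label that shares a variable with a label of the tree has a deeper candidate. -/
theorem exists_cand_of_involves {L : ↥ℬ → Fin K} {τ : WTree (Option ι) (Event α K)}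
    (hτ : τ.Valid (Allowed L)) {e f : Event α K} {π : List (Option ι)} (hf : τ.get π = some f)
    {i : ι} (hi : Involves i f.2) (hi' : Involves i e.2) :
    ∃ q, τ.Cand (Allowed L) e q ∧ π.length < q.length :=
  WTree.exists_cand_of_persistent (s := some i) hτ (fun _ _ h1 h2 => ⟨h1.2, h2.2⟩) hf ⟨hi, hi'⟩

/-- The new leaf lies strictly deeper than every label involving i, since each of those offers a
deeper candidate. Hence the only demand on i is that of the new leaf, and `x` meets it. -/
theorem cost_insert_of_involves (p : Elem α → ℝ) {L : ↥ℬ → Fin K}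
    {τ : WTree (Option ι) (Event α K)} (hτ : τ.Valid (Allowed L))
    {e : Event α K} {π : List (Option ι)} (hπ : τ.MaxCand (Allowed L) e π) {i : ι}
    (hi : Involves i e.2) {x : ∀ i, α i} (hx : Holds x e.2) :
    cost p (τ.insert e π) i (x i) = (p ⟨i, x i⟩)⁻¹ := by
  classical
  have hroot : (τ.insert e π).get π = some e := by simp [WTree.get_insert e hπ.1.1]
  rw [cost, if_pos ⟨π, e, hroot, hi⟩, if_pos]
  rintro j ⟨q, f, hf, hj, hm⟩
  rw [WTree.get_insert e hπ.1.1] at hf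
  split_ifs at hf with h
  · cases hf
    exact hx _ hj
  · obtain ⟨r, hr, hl⟩ := exists_cand_of_involves hτ hf ⟨j, hj⟩ hi
    have := hπ.2 r hr
    have := hm π e hroot hi
    omega

/-- A bound for the conditional probability that the run extends to one with witness tree `τ`,
given the current assignment `x`. -/
noncomputable def potential (Q : Fin K → Finset (Elem α) → ℝ) (p : Elem α → ℝ)
    (τ : WTree (Option ι) (Event α K)) (x : ∀ i, α i) : ℝ :=
  τ.weight (eventWeight Q p) * ∏ i, cost p τ i (x i)

theorem potential_nil (Q : Fin K → Finset (Elem α) → ℝ) (p : Elem α → ℝ) (x : ∀ i, α i) :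
    potential Q p .nil x = 1 := by
  simp [potential, cost_of_not_occurs p (not_occurs_nil _)]

theorem potential_nonneg {Q : Fin K → Finset (Elem α) → ℝ} {p : Elem α → ℝ}
    (hQ : ∀ k Y, 0 ≤ Q k Y) (hp : ∀ e, 0 ≤ p e) (τ : WTree (Option ι) (Event α K))
    (x : ∀ i, α i) : 0 ≤ potential Q p τ x :=
  mul_nonneg (WTree.weight_nonneg (eventWeight_nonneg hQ hp) τ)
    (Finset.prod_nonneg fun i _ => cost_nonneg hp τ i _)

open Classical in
theorem setPow_eq_prod (p : Elem α → ℝ) {x : ∀ i, α i} {Y : Finset (Elem α)} (hx : Holds x Y) :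
    setPow p Y = ∏ i, if Involves i Y then p ⟨i, x i⟩ else 1 := by
  rw [setPow, ← Finset.prod_fiberwise Y (fun e => e.1) p]
  refine Finset.prod_congr rfl fun i _ => ?_
  split_ifs with h
  · obtain ⟨j, hj⟩ := h
    obtain rfl : x i = j := hx _ hj
    rw [Finset.prod_eq_single_of_mem (⟨i, x i⟩ : Elem α) (by simp [hj])]
    rintro ⟨i', j'⟩ hb hne
    obtain ⟨hb', rfl⟩ := Finset.mem_filter.1 hb
    obtain rfl : x i' = j' := hx ⟨i', j'⟩ hb'
    exact absurd rfl hne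
  · refine Finset.prod_eq_one fun e he => ?_
    obtain ⟨i', j'⟩ := e
    obtain ⟨he', rfl⟩ := Finset.mem_filter.1 he
    exact absurd ⟨j', he'⟩ h

-- The factor p^Y of the new label cancels the inverse probabilities that its variables now cost;
-- the costs of all other variables are unchanged. Only Q and the potential of the smaller tree with
-- the variables of Y freed remain.
open Classical in
theorem potential_insert (Q : Fin K → Finset (Elem α) → ℝ) {p : Elem α → ℝ} {L : ↥ℬ → Fin K}
    {τ : WTree (Option ι) (Event α K)} (hτ : τ.Valid (Allowed L))
    {e : Event α K} {π : List (Option ι)} (hπ : τ.MaxCand (Allowed L) e π)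
    {x : ∀ i, α i} (hx : Holds x e.2) (hpos : ∀ i, 0 < p ⟨i, x i⟩) :
    potential Q p (τ.insert e π) x = Q e.1 e.2 * (τ.weight (eventWeight Q p) *
      ∏ i, if Involves i e.2 then 1 else cost p τ i (x i)) := by
  have : setPow p e.2 * ∏ i, cost p (τ.insert e π) i (x i) =
      ∏ i, if Involves i e.2 then 1 else cost p τ i (x i) := by
    rw [setPow_eq_prod p hx, ← Finset.prod_mul_distrib]
    refine Finset.prod_congr rfl fun i _ => ?_
    split_ifs with h
    · rw [cost_insert_of_involves p hτ hπ h hx, mul_inv_cancel₀ (hpos i).ne']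
    · rw [cost_insert_of_not_involves p hπ.1.1 h, one_mul]
  rw [← this, potential, WTree.weight_insert _ e hπ.1.1, eventWeight]
  ring

variable [∀ i, Fintype (α i)]

-- The potential is a product over variables, so averaging it against a product distribution can be
-- done one variable at a time.
open Classical in
theorem sum_prod_mul_potential (Q : Fin K → Finset (Elem α) → ℝ) (p : Elem α → ℝ)
    (τ : WTree (Option ι) (Event α K)) (g : ∀ i, α i → ℝ) :
    ∑ x : ∀ i, α i, (∏ i, g i (x i)) * potential Q p τ x =
      τ.weight (eventWeight Q p) * ∏ i, ∑ a, g i a * cost p τ i a := by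
  rw [Finset.prod_univ_sum, Fintype.piFinset_univ, Finset.mul_sum]
  refine Finset.sum_congr rfl fun x _ => ?_
  rw [potential, Finset.prod_mul_distrib]
  ring

open Classical in
theorem sum_initial_potential_le {Q : Fin K → Finset (Elem α) → ℝ} {p : Elem α → ℝ}
    (hQ : ∀ k Y, 0 ≤ Q k Y) (hp : ∀ e, 0 ≤ p e) (hp1 : ∀ i, ∑ a, p ⟨i, a⟩ = 1)
    (τ : WTree (Option ι) (Event α K)) :
    ∑ x : ∀ i, α i, (∏ i, p ⟨i, x i⟩) * potential Q p τ x ≤ τ.weight (eventWeight Q p) := by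
  rw [sum_prod_mul_potential Q p τ fun i a => p ⟨i, a⟩]
  exact mul_le_of_le_one_right (WTree.weight_nonneg (eventWeight_nonneg hQ hp) τ)
    (Finset.prod_le_one (fun i _ => Finset.sum_nonneg fun a _ => mul_nonneg (hp _)
      (cost_nonneg hp τ i a)) fun i _ => sum_mul_cost_le hp1 τ i)

open Classical in
theorem sum_resampleProb_mul_potential_le {Q : Fin K → Finset (Elem α) → ℝ} {p : Elem α → ℝ}
    (hQ : ∀ k Y, 0 ≤ Q k Y) (hp : ∀ e, 0 ≤ p e) (hp1 : ∀ i, ∑ a, p ⟨i, a⟩ = 1)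
    (τ : WTree (Option ι) (Event α K)) (x : ∀ i, α i) (Y : Finset (Elem α)) :
    ∑ x' : ∀ i, α i, resampleProb p x Y x' * potential Q p τ x' ≤
      τ.weight (eventWeight Q p) * ∏ i, if Involves i Y then 1 else cost p τ i (x i) := by
  unfold resampleProb
  rw [sum_prod_mul_potential Q p τ fun i a =>
    if Involves i Y then p ⟨i, a⟩ else if a = x i then 1 else 0]
  refine mul_le_mul_of_nonneg_left (Finset.prod_le_prod (fun i _ => ?_) fun i _ => ?_)
    (WTree.weight_nonneg (eventWeight_nonneg hQ hp) τ)
  · refine Finset.sum_nonneg fun a _ => mul_nonneg ?_ (cost_nonneg hp τ i a)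
    split_ifs
    exacts [hp _, zero_le_one, le_rfl]
  · split_ifs with h
    · exact sum_mul_cost_le hp1 τ i
    · simp

open Classical in
theorem sum_resampleProb_mul_potential_le_self {Q : Fin K → Finset (Elem α) → ℝ}
    {p : Elem α → ℝ} (hQ : ∀ k Y, 0 ≤ Q k Y) (hp : ∀ e, 0 ≤ p e)
    (hp1 : ∀ i, ∑ a, p ⟨i, a⟩ = 1) {τ : WTree (Option ι) (Event α K)} (x : ∀ i, α i)
    {Y : Finset (Elem α)} (hY : ∀ i, Involves i Y → ¬ Occurs τ i) :
    ∑ x' : ∀ i, α i, resampleProb p x Y x' * potential Q p τ x' ≤ potential Q p τ x := by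
  refine (sum_resampleProb_mul_potential_le hQ hp hp1 τ x Y).trans_eq ?_
  rw [potential]
  congr 1
  refine Finset.prod_congr rfl fun i _ => ?_
  split_ifs with h
  · rw [cost_of_not_occurs p (hY i h)]
  · rfl

theorem sum_selectProb {L : ↥ℬ → Fin K} {Q : Fin K → Finset (Elem α) → ℝ}
    (hQ : ∀ k, IsFracHittingSet (Q k) (labelClass L k)) (v : Option ↥ℬ) :
    ∑ Y, selectProb L Q v Y = 1 := by
  classical
  cases v with
  | none => simp [selectProb]
  | some B =>
    simp only [selectProb]
    rw [← Finset.sum_filter, show (Finset.univ.filter fun Y => Y ⊆ B.1) = B.1.powerset by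
      ext; simp, ← Finset.sum_div, div_self]
    have := one_le_sum_powerset hQ B
    linarith

end Potential

/-! ### One step of the run and the witness tree lemma -/

theorem sum_measureReal_inter_fiber {Ω β : Type*} [Fintype β] [MeasurableSpace Ω]
    (P : Measure Ω) [IsFiniteMeasure P] {f : Ω → β} (hf : ∀ b, MeasurableSet {ω | f ω = b})
    (A : Set Ω) : ∑ b, P.real (A ∩ {ω | f ω = b}) = P.real A := by
  have h := sum_measureReal_preimage_singleton (μ := P.restrict A) Finset.univ (f := f)
    fun b _ => hf b
  rw [Finset.coe_univ, Set.preimage_univ, measureReal_restrict_apply_univ] at h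
  rw [← h]
  refine Finset.sum_congr rfl fun b _ => ?_
  rw [measureReal_restrict_apply (t := f ⁻¹' {b}) (hf b), Set.inter_comm]
  rfl

section Run

variable {ι : Type*} {α : ι → Type*} {K : ℕ}
  {ℬ : Finset (Finset (Elem α))} {Ω : Type*}

theorem history_succ (X : ℕ → Ω → ∀ i, α i) (V : ℕ → Ω → Option ↥ℬ)
    (R : ℕ → Ω → Finset (Elem α)) (t : ℕ) (x : ℕ → ∀ i, α i) (v : ℕ → Option ↥ℬ)
    (y : ℕ → Finset (Elem α)) (Y : Finset (Elem α)) (x' : ∀ i, α i) (v' : Option ↥ℬ) :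
    history X V R (t + 1) (Function.update x (t + 1) x') (Function.update v (t + 1) v')
      (Function.update y t Y) =
    history X V R t x v y ∩ {ω | R t ω = Y} ∩ {ω | X (t + 1) ω = x'} ∩
      {ω | V (t + 1) ω = v'} := by
  ext ω
  simp only [history, Set.mem_inter_iff, Set.mem_ofPred_eq]
  constructor
  · rintro ⟨h1, h2⟩
    refine ⟨⟨⟨⟨fun s hs => ?_, fun s hs => ?_⟩, ?_⟩, ?_⟩, ?_⟩
    · have h := h1 s (by omega)
      have hne : s ≠ t + 1 := by omega
      simpa [Function.update_of_ne hne] using h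
    · have h := h2 s (by omega)
      simpa [Function.update_of_ne hs.ne] using h
    · simpa using h2 t (by omega)
    · simpa using (h1 (t + 1) le_rfl).1
    · simpa using (h1 (t + 1) le_rfl).2
  · rintro ⟨⟨⟨⟨h1, h2⟩, h3⟩, h4⟩, h5⟩
    refine ⟨fun s hs => ?_, fun s hs => ?_⟩
    · rcases eq_or_ne s (t + 1) with rfl | hne
      · simp [h4, h5]
      · simpa [Function.update_of_ne hne] using h1 s (by omega)
    · rcases eq_or_ne s t with rfl | hne
      · simp [h3]
      · simpa [Function.update_of_ne hne] using h2 s (by omega)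

theorem history_update (X : ℕ → Ω → ∀ i, α i) (V : ℕ → Ω → Option ↥ℬ)
    (R : ℕ → Ω → Finset (Elem α)) (t : ℕ) (x : ℕ → ∀ i, α i) (v : ℕ → Option ↥ℬ)
    (y : ℕ → Finset (Elem α)) (Y : Finset (Elem α)) (x' : ∀ i, α i) :
    history X V R t (Function.update x (t + 1) x') v (Function.update y t Y) =
      history X V R t x v y := by
  ext ω
  simp only [history, Set.mem_ofPred_eq]
  refine and_congr (forall₂_congr fun s hs => ?_) (forall₂_congr fun s hs => ?_)
  · rw [Function.update_of_ne (by omega)]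
  · rw [Function.update_of_ne hs.ne]

/-- The label of iteration `t`, if the run has not stopped. -/
def runEvent (L : ↥ℬ → Fin K) (V : ℕ → Ω → Option ↥ℬ) (R : ℕ → Ω → Finset (Elem α)) (t : ℕ)
    (ω : Ω) : Option (Event α K) :=
  (V t ω).map fun B => (L B, R t ω)

variable [Fintype ι]

/-- The witness tree of the iterations `t, …, t + m - 1`. -/
noncomputable def witness (L : ↥ℬ → Fin K) (V : ℕ → Ω → Option ↥ℬ)
    (R : ℕ → Ω → Finset (Elem α)) : ℕ → ℕ → Ω → WTree (Option ι) (Event α K)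
  | _, 0, _ => .nil
  | t, m + 1, ω => (runEvent L V R t ω).elim (witness L V R (t + 1) m ω)
      fun e => (witness L V R (t + 1) m ω).step (Allowed L) e

/-- The event that `τ` is the witness tree of a run of at most `n` iterations from time `t`. -/
def reaches (L : ↥ℬ → Fin K) (V : ℕ → Ω → Option ↥ℬ) (R : ℕ → Ω → Finset (Elem α)) (t n : ℕ)
    (τ : WTree (Option ι) (Event α K)) : Set Ω :=
  {ω | ∃ m ≤ n, witness L V R t m ω = τ}

theorem witness_valid (L : ↥ℬ → Fin K) (V : ℕ → Ω → Option ↥ℬ) (R : ℕ → Ω → Finset (Elem α))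
    (t m : ℕ) (ω : Ω) : (witness L V R t m ω).Valid (Allowed L) := by
  induction m generalizing t with
  | zero => exact WTree.valid_nil
  | succ m ih =>
    rw [witness]
    cases runEvent L V R t ω with
    | none => exact ih _
    | some e => exact (ih _).step e

theorem exists_of_mem_reaches_succ {L : ↥ℬ → Fin K} {V : ℕ → Ω → Option ↥ℬ}
    {R : ℕ → Ω → Finset (Elem α)} {t n : ℕ} {τ : WTree (Option ι) (Event α K)} {ω : Ω}
    (hτ : τ ≠ .nil) (h : ω ∈ reaches L V R t (n + 1) τ) :
    ∃ τ', τ'.Valid (Allowed L) ∧ ω ∈ reaches L V R (t + 1) n τ' ∧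
      (runEvent L V R t ω).elim τ' (fun e => τ'.step (Allowed L) e) = τ := by
  obtain ⟨m, hm, h⟩ := h
  cases m with
  | zero => exact absurd h.symm hτ
  | succ m =>
    exact ⟨witness L V R (t + 1) m ω, witness_valid _ _ _ _ _ _, ⟨m, by omega, rfl⟩, h⟩

theorem resampleProb_nonneg {p : Elem α → ℝ} (hp : ∀ e, 0 ≤ p e) (x : ∀ i, α i)
    (Y : Finset (Elem α)) (x' : ∀ i, α i) : 0 ≤ resampleProb p x Y x' := by
  refine Finset.prod_nonneg fun i _ => ?_
  split_ifs
  exacts [hp _, zero_le_one, le_rfl]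

/-- Keeps the induction among assignments whose values all have positive probability, as the
cancellation of p against p⁻¹ needs. -/
theorem resampleProb_eq_zero {p : Elem α → ℝ} {x x' : ∀ i, α i} (Y : Finset (Elem α))
    (hx : ∀ i, 0 < p ⟨i, x i⟩) {i : ι} (hi : ¬ 0 < p ⟨i, x' i⟩) (hp : ∀ e, 0 ≤ p e) :
    resampleProb p x Y x' = 0 := by
  refine Finset.prod_eq_zero (Finset.mem_univ i) ?_
  split_ifs with h1 h2
  · exact le_antisymm (not_lt.1 hi) (hp _)
  · exact absurd (h2 ▸ hx i) hi
  · rfl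

variable [MeasurableSpace Ω] {P : Measure Ω} {p : Elem α → ℝ}
  {L : ↥ℬ → Fin K} {Q : Fin K → Finset (Elem α) → ℝ} {X : ℕ → Ω → ∀ i, α i}
  {V : ℕ → Ω → Option ↥ℬ} {R : ℕ → Ω → Finset (Elem α)}

namespace IsExecution

theorem real_select (h : IsExecution p ℬ L Q P X V R) (hQ : ∀ k Y, 0 ≤ Q k Y) (t : ℕ)
    (x : ℕ → ∀ i, α i) (v : ℕ → Option ↥ℬ) (y : ℕ → Finset (Elem α)) (Y : Finset (Elem α)) :
    P.real (history X V R t x v y ∩ {ω | R t ω = Y}) =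
      P.real (history X V R t x v y) * selectProb L Q (v t) Y := by
  have := h.select t x v (Function.update y t Y)
  have hh := history_update X V R t x v y Y (x (t + 1))
  rw [Function.update_eq_self] at hh
  rw [hh, Function.update_self] at this
  rw [measureReal_def, this, ENNReal.toReal_mul, ENNReal.toReal_ofReal (selectProb_nonneg hQ _ _)]
  rfl

theorem real_resample (h : IsExecution p ℬ L Q P X V R) (hp : ∀ e, 0 ≤ p e) (t : ℕ)
    (x : ℕ → ∀ i, α i) (v : ℕ → Option ↥ℬ) (y : ℕ → Finset (Elem α)) (Y : Finset (Elem α))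
    (x' : ∀ i, α i) :
    P.real (history X V R t x v y ∩ {ω | R t ω = Y} ∩ {ω | X (t + 1) ω = x'}) =
      P.real (history X V R t x v y ∩ {ω | R t ω = Y}) * resampleProb p (x t) Y x' := by
  have := h.resample t (Function.update x (t + 1) x') v (Function.update y t Y)
  rw [history_update, Function.update_self, Function.update_self,
    Function.update_of_ne (by omega)] at this
  rw [measureReal_def, this, ENNReal.toReal_mul,
    ENNReal.toReal_ofReal (resampleProb_nonneg hp _ _ _)]
  rfl

variable [∀ i, Fintype (α i)] [IsProbabilityMeasure P]

open Classical in
/-- An event is split according to the next assignment and the next violated set. -/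
theorem real_inter_eq_sum (h : IsExecution p ℬ L Q P X V R) (t : ℕ)
    (x : ℕ → ∀ i, α i) (v : ℕ → Option ↥ℬ) (y : ℕ → Finset (Elem α)) (Y : Finset (Elem α))
    (E : Set Ω) :
    P.real (history X V R t x v y ∩ {ω | R t ω = Y} ∩ E) = ∑ x' : ∀ i, α i, ∑ v' : Option ↥ℬ,
      P.real (history X V R (t + 1) (Function.update x (t + 1) x') (Function.update v (t + 1) v')
        (Function.update y t Y) ∩ E) := by
  rw [← sum_measureReal_inter_fiber P (h.measurable_assignment (t + 1))]
  refine Finset.sum_congr rfl fun x' _ => ?_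
  rw [← sum_measureReal_inter_fiber P (h.measurable_violated (t + 1))]
  refine Finset.sum_congr rfl fun v' _ => ?_
  rw [history_succ]
  congr 1
  ext ω
  simp only [Set.mem_inter_iff, Set.mem_ofPred_eq]
  tauto

open Classical in
/-- One step of the run: a bound for the next states gives a bound for the present one. -/
theorem real_inter_le (h : IsExecution p ℬ L Q P X V R) (hQ : ∀ k Y, 0 ≤ Q k Y)
    (hp : ∀ e, 0 ≤ p e) (t : ℕ) (x : ℕ → ∀ i, α i) (v : ℕ → Option ↥ℬ)
    (y : ℕ → Finset (Elem α)) (Y : Finset (Elem α)) (E : Set Ω) (F : (∀ i, α i) → ℝ)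
    (hx : ∀ i, 0 < p ⟨i, x t i⟩)
    (hF : ∀ (x' : ℕ → ∀ i, α i) (v' : ℕ → Option ↥ℬ) (y' : ℕ → Finset (Elem α)),
      (∀ i, 0 < p ⟨i, x' (t + 1) i⟩) → P.real (history X V R (t + 1) x' v' y' ∩ E) ≤
        P.real (history X V R (t + 1) x' v' y') * F (x' (t + 1))) :
    P.real (history X V R t x v y ∩ {ω | R t ω = Y} ∩ E) ≤
      P.real (history X V R t x v y) * selectProb L Q (v t) Y *
        ∑ x' : ∀ i, α i, resampleProb p (x t) Y x' * F x' := by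
  rw [h.real_inter_eq_sum, Finset.mul_sum]
  refine Finset.sum_le_sum fun x' _ => ?_
  have hsum : ∑ v' : Option ↥ℬ, P.real (history X V R (t + 1) (Function.update x (t + 1) x')
      (Function.update v (t + 1) v') (Function.update y t Y)) =
      P.real (history X V R t x v y) * selectProb L Q (v t) Y * resampleProb p (x t) Y x' := by
    rw [← h.real_select hQ, ← h.real_resample hp,
      ← sum_measureReal_inter_fiber P (h.measurable_violated (t + 1))]
    exact Finset.sum_congr rfl fun v' _ => by rw [history_succ]
  rw [← mul_assoc, ← hsum, Finset.sum_mul]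
  by_cases hx' : ∀ i, 0 < p ⟨i, x' i⟩
  · refine Finset.sum_le_sum fun v' _ => ?_
    have := hF (Function.update x (t + 1) x') (Function.update v (t + 1) v')
      (Function.update y t Y) (by simpa using hx')
    simpa using this
  · push Not at hx'
    obtain ⟨i, hi⟩ := hx'
    rw [resampleProb_eq_zero Y hx (not_lt.2 hi) hp, mul_zero] at hsum
    have hz := (Finset.sum_eq_zero_iff_of_nonneg fun v' _ => measureReal_nonneg).1 hsum
    refine Finset.sum_le_sum fun v' hv' => ?_
    rw [hz v' hv', zero_mul, ← hz v' hv']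
    exact measureReal_mono Set.inter_subset_left

end IsExecution

variable [∀ i, Fintype (α i)] [IsProbabilityMeasure P]

/-- The witness tree lemma, conditionally on a history. -/
theorem IsExecution.real_history_inter_reaches_le (h : IsExecution p ℬ L Q P X V R)
    (hQ : ∀ k, IsFracHittingSet (Q k) (labelClass L k)) (hp : ∀ e, 0 ≤ p e)
    (hp1 : ∀ i, ∑ a, p ⟨i, a⟩ = 1) (n t : ℕ) (τ : WTree (Option ι) (Event α K))
    (x : ℕ → ∀ i, α i) (v : ℕ → Option ↥ℬ) (y : ℕ → Finset (Elem α))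
    (hx : ∀ i, 0 < p ⟨i, x t i⟩) :
    P.real (history X V R t x v y ∩ reaches L V R t n τ) ≤
      P.real (history X V R t x v y) * potential Q p τ (x t) := by
  classical
  have hQ0 : ∀ k Y, 0 ≤ Q k Y := fun k => (hQ k).nonneg
  by_cases hτ : τ = .nil
  · rw [hτ, potential_nil, mul_one]
    exact measureReal_mono Set.inter_subset_left
  induction n generalizing t τ x v y with
  | zero =>
    have : reaches L V R t 0 τ = ∅ := by
      ext ω
      simp only [reaches, Nat.le_zero, Set.mem_ofPred_eq, Set.mem_empty_iff_false, iff_false]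
      rintro ⟨m, rfl, hm⟩
      exact hτ hm.symm
    rw [this, Set.inter_empty, measureReal_empty]
    exact mul_nonneg measureReal_nonneg (potential_nonneg hQ0 hp _ _)
  | succ n ih =>
    -- The induction excludes `nil`, whose potential is 1 and whose bound is trivial; it is added
    -- back here, since the remaining tree may be empty.
    have ih' : ∀ τ' (x' : ℕ → ∀ i, α i) (v' : ℕ → Option ↥ℬ) (y' : ℕ → Finset (Elem α)),
        (∀ i, 0 < p ⟨i, x' (t + 1) i⟩) →
        P.real (history X V R (t + 1) x' v' y' ∩ reaches L V R (t + 1) n τ') ≤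
          P.real (history X V R (t + 1) x' v' y') * potential Q p τ' (x' (t + 1)) := by
      intro τ' x' v' y' hx'
      by_cases hτ' : τ' = .nil
      · rw [hτ', potential_nil, mul_one]
        exact measureReal_mono Set.inter_subset_left
      · exact ih (t + 1) τ' x' v' y' hx' hτ'
    set H := history X V R t x v y with hH
    have hV : ∀ ω ∈ H, V t ω = v t := fun ω hω => (hω.1 t le_rfl).2
    have hφ := potential_nonneg hQ0 hp τ (x t)
    have hstep : ∀ Y τ', P.real (H ∩ {ω | R t ω = Y} ∩ reaches L V R (t + 1) n τ') ≤
        P.real H * selectProb L Q (v t) Y *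
          ∑ x' : ∀ i, α i, resampleProb p (x t) Y x' * potential Q p τ' x' := fun Y τ' =>
      h.real_inter_le hQ0 hp t x v y Y _ _ hx (ih' τ')
    have hsel : ∀ Y, 0 ≤ P.real H * selectProb L Q (v t) Y := fun Y =>
      mul_nonneg measureReal_nonneg (selectProb_nonneg hQ0 _ _)
    rw [← sum_measureReal_inter_fiber P (h.measurable_resampled t)]
    have hcomm : ∀ Y, H ∩ reaches L V R t (n + 1) τ ∩ {ω | R t ω = Y} =
        H ∩ {ω | R t ω = Y} ∩ reaches L V R t (n + 1) τ := fun Y => Set.inter_right_comm _ _ _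
    simp only [hcomm]
    -- For iterations that leave τ unchanged: the bounds for the single sets Y add up, because the
    -- selection probabilities sum to 1.
    have hskip : (∀ Y, P.real (H ∩ {ω | R t ω = Y} ∩ reaches L V R t (n + 1) τ) ≤
        P.real H * selectProb L Q (v t) Y * potential Q p τ (x t)) →
        ∑ Y, P.real (H ∩ {ω | R t ω = Y} ∩ reaches L V R t (n + 1) τ) ≤
          P.real H * potential Q p τ (x t) := by
      intro hY
      refine (Finset.sum_le_sum fun Y _ => hY Y).trans_eq ?_
      rw [← Finset.sum_mul, ← Finset.mul_sum, sum_selectProb hQ, mul_one]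
    have hnull : ∀ Y, selectProb L Q (v t) Y = 0 → ∀ E, P.real (H ∩ {ω | R t ω = Y} ∩ E) ≤ 0 := by
      intro Y hY E
      have := h.real_select hQ0 t x v y Y
      rw [hY, mul_zero] at this
      rw [← this]
      exact measureReal_mono Set.inter_subset_left
    rcases H.eq_empty_or_nonempty with hH0 | ⟨ω₀, hω₀⟩
    · simp [hH0]
    cases hvt : v t with
    | none =>
      rw [hvt] at hV hstep hsel hskip hnull
      refine hskip fun Y => ?_
      by_cases hY : Y = ∅
      · have hsub : H ∩ {ω | R t ω = Y} ∩ reaches L V R t (n + 1) τ ⊆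
            H ∩ {ω | R t ω = Y} ∩ reaches L V R (t + 1) n τ := by
          rintro ω ⟨hω, hr⟩
          obtain ⟨τ', -, hr', he⟩ := exists_of_mem_reaches_succ hτ hr
          simp only [runEvent, hV ω hω.1, Option.map_none, Option.elim_none] at he
          exact ⟨hω, he ▸ hr'⟩
        refine (measureReal_mono hsub).trans ((hstep Y τ).trans
          (mul_le_mul_of_nonneg_left ?_ (hsel Y)))
        refine sum_resampleProb_mul_potential_le_self hQ0 hp hp1 _ fun i hi => ?_
        simp [hY, Involves] at hi
      · have h0 : selectProb L Q none Y = 0 := by simp [selectProb, hY]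
        rw [h0, mul_zero, zero_mul]
        exact hnull Y h0 _
    | some B =>
      rw [hvt] at hV hstep hsel hskip hnull
      have hB : Holds (x t) B.1 := by
        have := h.violated_holds t ω₀ B (hV ω₀ hω₀)
        rwa [(hω₀.1 t le_rfl).1] at this
      have hsub0 : ∀ Y, ¬ Y ⊆ B.1 → selectProb L Q (some B) Y = 0 := fun Y hY => by
        simp [selectProb, hY]
      have hmem : ∀ Y ω, ω ∈ H ∩ {ω | R t ω = Y} ∩ reaches L V R t (n + 1) τ →
          ∃ τ', τ'.Valid (Allowed L) ∧ ω ∈ reaches L V R (t + 1) n τ' ∧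
            τ'.step (Allowed L) (L B, Y) = τ := by
        rintro Y ω ⟨⟨hω, hR⟩, hr⟩
        obtain ⟨τ', hv, hr', he⟩ := exists_of_mem_reaches_succ hτ hr
        have hR' : R t ω = Y := hR
        refine ⟨τ', hv, hr', ?_⟩
        simpa [runEvent, hV ω hω, hR'] using he
      -- Either some subset of B can be the last leaf attached to τ, or the present iteration leaves
      -- no trace in τ.
      by_cases hA : ∃ Y₀ ⊆ B.1, ∃ (τ₀ : WTree (Option ι) (Event α K)) (q : _), τ₀.Valid (Allowed L) ∧
          τ₀.MaxCand (Allowed L) (L B, Y₀) q ∧ τ₀.insert (L B, Y₀) q = τ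
      · obtain ⟨Y₀, hY₀, τ₀, q, hv₀, hq, rfl⟩ := hA
        have huniq : ∀ Y ⊆ B.1, ∀ τ', τ'.step (Allowed L) (L B, Y) = τ₀.insert (L B, Y₀) q →
            Y = Y₀ ∧ τ' = τ₀ := by
          intro Y hY τ' he
          rcases WTree.step_cases (Allowed L) (L B, Y) τ' with ⟨r, hr, hs⟩ | ⟨hc, hs⟩
          · obtain ⟨h1, h2⟩ := WTree.insert_maxCand_unique hr hq (hs.symm.trans he)
              (exists_allowed hY hY₀) (exists_allowed hY₀ hY)
            exact ⟨congrArg Prod.snd h1, h2⟩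
          -- Y cannot have been skipped: it conflicts with Y₀, which is a node of τ, and so has a
          -- candidate.
          · rw [hs] at he
            obtain ⟨r, hr⟩ := WTree.exists_cand_insert hq.1.1 (exists_allowed (L := L) hY₀ hY)
            exact absurd (he ▸ hr) (hc r)
        have hle : ∀ Y ≠ Y₀, P.real (H ∩ {ω | R t ω = Y} ∩
            reaches L V R t (n + 1) (τ₀.insert (L B, Y₀) q)) ≤ 0 := by
          intro Y hne
          by_cases hY : Y ⊆ B.1
          · have he : H ∩ {ω | R t ω = Y} ∩ reaches L V R t (n + 1) (τ₀.insert (L B, Y₀) q) = ∅ :=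
              Set.eq_empty_of_forall_notMem fun ω hω => by
                obtain ⟨τ', -, -, he⟩ := hmem Y ω hω
                exact hne (huniq Y hY τ' he).1
            rw [he, measureReal_empty]
          · exact hnull Y (hsub0 Y hY) _
        have hx₀ : Holds (x t) Y₀ := fun e he => hB e (hY₀ he)
        rw [← Finset.add_sum_erase _ _ (Finset.mem_univ Y₀)]
        refine (add_le_of_nonpos_right (Finset.sum_nonpos fun Y hY =>
          hle Y (Finset.ne_of_mem_erase hY))).trans ?_
        have hsub : H ∩ {ω | R t ω = Y₀} ∩ reaches L V R t (n + 1) (τ₀.insert (L B, Y₀) q) ⊆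
            H ∩ {ω | R t ω = Y₀} ∩ reaches L V R (t + 1) n τ₀ := by
          intro ω hω
          obtain ⟨τ', -, hr', he⟩ := hmem Y₀ ω hω
          exact ⟨hω.1, (huniq Y₀ hY₀ τ' he).2 ▸ hr'⟩
        refine (measureReal_mono hsub).trans ((hstep Y₀ τ₀).trans ?_)
        -- Selecting Y₀ costs at most Q(Y₀), and redrawing its variables averages their costs in τ₀
        -- to at most 1: exactly the potential of τ.
        rw [potential_insert Q hv₀ hq hx₀ hx, mul_assoc]
        refine mul_le_mul_of_nonneg_left ?_ measureReal_nonneg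
        refine mul_le_mul (selectProb_le hQ B Y₀)
          (sum_resampleProb_mul_potential_le hQ0 hp hp1 τ₀ (x t) Y₀) ?_ (hQ0 _ _)
        exact Finset.sum_nonneg fun x' _ => mul_nonneg (resampleProb_nonneg hp _ _ _)
          (potential_nonneg hQ0 hp _ _)
      · push Not at hA
        refine hskip fun Y => ?_
        by_cases hY : Y ⊆ B.1
        · have hno : ∀ τ', τ'.Valid (Allowed L) → τ'.step (Allowed L) (L B, Y) = τ →
              τ' = τ ∧ ∀ r, ¬ τ.Cand (Allowed L) (L B, Y) r := by
            intro τ' hv' he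
            rcases WTree.step_cases (Allowed L) (L B, Y) τ' with ⟨r, hr, hs⟩ | ⟨hc, hs⟩
            · exact absurd (hs.symm.trans he) (hA Y hY τ' r hv' hr)
            · obtain rfl := hs.symm.trans he
              exact ⟨rfl, hc⟩
          rcases (H ∩ {ω | R t ω = Y} ∩ reaches L V R t (n + 1) τ).eq_empty_or_nonempty with
            he | ⟨ω₁, hω₁⟩
          · rw [he, measureReal_empty]
            exact mul_nonneg (hsel Y) hφ
          obtain ⟨τ₁, hv₁, -, he₁⟩ := hmem Y ω₁ hω₁
          obtain ⟨rfl, hc⟩ := hno τ₁ hv₁ he₁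
          have hsub : H ∩ {ω | R t ω = Y} ∩ reaches L V R t (n + 1) τ₁ ⊆
              H ∩ {ω | R t ω = Y} ∩ reaches L V R (t + 1) n τ₁ := by
            intro ω hω
            obtain ⟨τ', hv', hr', he⟩ := hmem Y ω hω
            exact ⟨hω.1, (hno τ' hv' he).1 ▸ hr'⟩
          refine (measureReal_mono hsub).trans ((hstep Y τ₁).trans
            (mul_le_mul_of_nonneg_left ?_ (hsel Y)))
          -- A label without a candidate shares no variable with τ, so redrawing its variables does
          -- not affect the potential.
          refine sum_resampleProb_mul_potential_le_self hQ0 hp hp1 _ fun i hi => ?_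
          rintro ⟨π, f, hf, hif⟩
          obtain ⟨r, hr, -⟩ := exists_cand_of_involves (e := (L B, Y)) hv₁ hf hif hi
          exact hc r hr
        · rw [hsub0 Y hY, mul_zero, zero_mul]
          exact hnull Y (hsub0 Y hY) _

/-- The witness tree lemma. -/
theorem IsExecution.real_reaches_le (h : IsExecution p ℬ L Q P X V R)
    (hQ : ∀ k, IsFracHittingSet (Q k) (labelClass L k)) (hp : ∀ e, 0 ≤ p e)
    (hp1 : ∀ i, ∑ a, p ⟨i, a⟩ = 1) (n : ℕ) (τ : WTree (Option ι) (Event α K)) :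
    P.real (reaches L V R 0 n τ) ≤ τ.weight (eventWeight Q p) := by
  classical
  have hQ0 : ∀ k Y, 0 ≤ Q k Y := fun k => (hQ k).nonneg
  refine le_trans ?_ (sum_initial_potential_le hQ0 hp hp1 τ)
  rw [← sum_measureReal_inter_fiber P (h.measurable_assignment 0)]
  refine Finset.sum_le_sum fun x _ => ?_
  have hinit : P.real {ω | X 0 ω = x} = ∏ i, p ⟨i, x i⟩ := by
    rw [measureReal_def, h.initial, ENNReal.toReal_ofReal (Finset.prod_nonneg fun i _ => hp _)]
  rw [← hinit]
  by_cases hx : ∀ i, 0 < p ⟨i, x i⟩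
  · rw [← sum_measureReal_inter_fiber P (h.measurable_violated 0) {ω | X 0 ω = x},
      ← sum_measureReal_inter_fiber P (h.measurable_violated 0), Finset.sum_mul]
    refine Finset.sum_le_sum fun v _ => ?_
    have hh : history X V R 0 (fun _ => x) (fun _ => v) (fun _ => ∅) =
        {ω | X 0 ω = x} ∩ {ω | V 0 ω = v} := by
      ext ω
      simp [history]
    have := h.real_history_inter_reaches_le hQ hp hp1 n 0 τ (fun _ => x) (fun _ => v)
      (fun _ => ∅) hx
    rw [hh] at this
    refine le_trans (le_of_eq ?_) this
    congr 1
    ext ω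
    simp only [Set.mem_inter_iff, Set.mem_ofPred_eq]
    tauto
  · push Not at hx
    obtain ⟨i, hi⟩ := hx
    have h0 : P.real {ω | X 0 ω = x} = 0 := by
      rw [hinit, Finset.prod_eq_zero (Finset.mem_univ i) (le_antisymm hi (hp _))]
    rw [h0, zero_mul, ← h0]
    exact measureReal_mono Set.inter_subset_right

end Run

/-! ### Different resamplings have different witness trees -/

namespace WTree

theorem step_nil {σ ε : Type*} [Fintype σ] (A : ε → σ → ε → Prop) (e : ε) :
    (nil : WTree σ ε).step A e = node e fun _ => nil := by
  rcases step_cases A e nil with ⟨p, -, h⟩ | ⟨h, -⟩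
  · rw [h, insert]
  · exact absurd ⟨rfl, fun π s h => by simp at h⟩ (h [])

theorem step_get_nil {σ ε : Type*} [Fintype σ] (A : ε → σ → ε → Prop) (e : ε) {τ : WTree σ ε}
    {f : ε} (hf : τ.get [] = some f) : (τ.step A e).get [] = some f := by
  classical
  rcases step_cases A e τ with ⟨p, hp, h⟩ | ⟨-, h⟩
  · rw [h, get_insert e hp.1.1, if_neg, hf]
    rintro rfl
    rw [hp.1.1.get_eq] at hf
    cases hf
  · rw [h, hf]

end WTree

section Distinct

variable {ι : Type*} [Fintype ι] {α : ι → Type*} {K : ℕ} {ℬ : Finset (Finset (Elem α))}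
  {Ω : Type*} {L : ↥ℬ → Fin K} {V : ℕ → Ω → Option ↥ℬ} {R : ℕ → Ω → Finset (Elem α)}

/-- The last iteration is processed first, and later attachments never replace the root. -/
theorem witness_root {t m : ℕ} {ω : Ω} {e : Event α K}
    (h : runEvent L V R (t + m) ω = some e) : (witness L V R t (m + 1) ω).get [] = some e := by
  induction m generalizing t with
  | zero =>
    rw [add_zero] at h
    rw [witness, h]
    simp [witness, WTree.step_nil, WTree.get]
  | succ m ih =>
    have := ih (t := t + 1) (by rwa [add_assoc, add_comm 1])
    rw [witness]
    cases runEvent L V R t ω with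
    | none => exact this
    | some f => exact WTree.step_get_nil _ _ this

open Classical in
/-- Every earlier occurrence of the root label, a nonempty set, is a node of the witness tree. -/
theorem count_labels_witness {t m : ℕ} {ω : Ω} {e : Event α K} (he : e.2.Nonempty)
    (h : runEvent L V R (t + m) ω = some e) :
    (witness L V R t (m + 1) ω).labels.count e =
      ∑ s ∈ Finset.range (m + 1), if runEvent L V R (t + s) ω = some e then 1 else 0 := by
  induction m generalizing t with
  | zero =>
    rw [add_zero] at h
    rw [witness, h, zero_add, Finset.sum_range_one, add_zero, if_pos h]
    simp [witness, WTree.step_nil, WTree.labels]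
  | succ m ih =>
    have h' : runEvent L V R (t + 1 + m) ω = some e := by rwa [add_assoc, add_comm 1]
    have hc := ih h'
    have hr := witness_root h'
    have hshift : (∑ s ∈ Finset.range (m + 1),
        if runEvent L V R (t + (s + 1)) ω = some e then 1 else 0) =
          (witness L V R (t + 1) (m + 1) ω).labels.count e := by
      rw [hc]
      exact Finset.sum_congr rfl fun s _ => by rw [← add_assoc, add_right_comm]
    rw [Finset.sum_range_succ', witness, hshift, add_zero]
    cases hf : runEvent L V R t ω with
    | none => simp
    | some f =>
      simp only [Option.elim_some]
      rcases WTree.step_cases (Allowed L) f (witness L V R (t + 1) (m + 1) ω) with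
        ⟨p, hp, hs⟩ | ⟨hn, hs⟩
      · rw [hs, WTree.labels_insert f hp.1.1, Multiset.count_cons]
        congr 1
        simp [eq_comm]
      · rw [hs, if_neg, add_zero]
        intro heq
        cases heq
        -- A further copy of the root label shares a variable with the root, so it cannot be
        -- skipped. This is where nonemptiness enters.
        obtain ⟨⟨i, j⟩, hij⟩ := he
        obtain ⟨q, hq, -⟩ := exists_cand_of_involves (witness_valid L V R (t + 1) (m + 1) ω) hr
          ⟨j, hij⟩ ⟨j, hij⟩
        exact hn q hq

/-- The witness trees of different resamplings are different. -/
theorem witness_ne {s t : ℕ} (hst : s < t) {ω : Ω} {e f : Event α K} (he : e.2.Nonempty)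
    (hs : runEvent L V R s ω = some e) (ht : runEvent L V R t ω = some f) :
    witness L V R 0 (s + 1) ω ≠ witness L V R 0 (t + 1) ω := by
  classical
  intro heq
  rw [← zero_add s] at hs
  rw [← zero_add t] at ht
  have h1 := witness_root hs
  rw [heq, witness_root ht] at h1
  cases h1
  have h2 := count_labels_witness he hs
  rw [heq, count_labels_witness he ht] at h2
  -- Equal trees have equal roots, yet the count up to `t` includes iteration `t` itself and thus
  -- exceeds the count up to `s`.
  refine absurd h2 (Finset.sum_lt_sum_of_subset (i := t) ?_ ?_ ?_ ?_ ?_).ne'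
  · exact Finset.range_subset_range.2 (by omega)
  · simp
  · simp
    omega
  · rw [if_pos ht]
    exact one_pos
  · intro _ _ _
    exact Nat.zero_le _

end Distinct

/-! ### Measurability, expected counts and empty selections -/

section Main

variable {ι : Type*} [Fintype ι] {α : ι → Type*} {K : ℕ}
  {ℬ : Finset (Finset (Elem α))} {Ω : Type*}

theorem finite_range_witness [∀ i, Fintype (α i)] (L : ↥ℬ → Fin K) (V : ℕ → Ω → Option ↥ℬ)
    (R : ℕ → Ω → Finset (Elem α)) (t m : ℕ) : (Set.range (witness L V R t m)).Finite := by
  induction m generalizing t with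
  | zero =>
    refine (Set.finite_singleton WTree.nil).subset ?_
    rintro _ ⟨ω, rfl⟩
    rfl
  | succ m ih =>
    refine (Set.finite_iUnion fun o : Option (Event α K) => (ih (t + 1)).image fun τ =>
      o.elim τ fun e => τ.step (Allowed L) e).subset ?_
    rintro _ ⟨ω, rfl⟩
    exact Set.mem_iUnion.2 ⟨runEvent L V R t ω, _, ⟨ω, rfl⟩, rfl⟩

variable [MeasurableSpace Ω] {P : Measure Ω} {p : Elem α → ℝ}
  {L : ↥ℬ → Fin K} {Q : Fin K → Finset (Elem α) → ℝ} {X : ℕ → Ω → ∀ i, α i}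
  {V : ℕ → Ω → Option ↥ℬ} {R : ℕ → Ω → Finset (Elem α)}

theorem IsExecution.measurableSet_violated (h : IsExecution p ℬ L Q P X V R) (t : ℕ)
    (S : Set (Option ↥ℬ)) : MeasurableSet {ω | V t ω ∈ S} := by
  have : {ω | V t ω ∈ S} = ⋃ v ∈ S, {ω | V t ω = v} := by
    ext ω
    simp
  rw [this]
  exact MeasurableSet.biUnion S.to_countable fun v _ => h.measurable_violated t v

theorem IsExecution.measurableSet_running (h : IsExecution p ℬ L Q P X V R) (t : ℕ) :
    MeasurableSet {ω | V t ω ≠ none} :=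
  h.measurableSet_violated t {v | v ≠ none}

variable [∀ i, Fintype (α i)]

namespace IsExecution

theorem measurableSet_resampled (h : IsExecution p ℬ L Q P X V R) (t : ℕ)
    (S : Set (Finset (Elem α))) : MeasurableSet {ω | R t ω ∈ S} := by
  have : {ω | R t ω ∈ S} = ⋃ v ∈ S, {ω | R t ω = v} := by
    ext ω
    simp
  rw [this]
  exact MeasurableSet.biUnion S.to_countable fun v _ => h.measurable_resampled t v

theorem measurableSet_runEvent (h : IsExecution p ℬ L Q P X V R) (t : ℕ)
    (o : Option (Event α K)) : MeasurableSet {ω | runEvent L V R t ω = o} := by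
  have : {ω | runEvent L V R t ω = o} = ⋃ v : Option ↥ℬ, ⋃ Y : Finset (Elem α),
      {ω | V t ω = v ∧ R t ω = Y ∧ v.map (fun B => (L B, Y)) = o} := by
    ext ω
    simp [runEvent]
  rw [this]
  refine MeasurableSet.iUnion fun v => MeasurableSet.iUnion fun Y => ?_
  exact (h.measurable_violated t v).inter
    ((h.measurable_resampled t Y).inter (MeasurableSet.const _))

theorem measurableSet_witness (h : IsExecution p ℬ L Q P X V R) (t m : ℕ)
    (S : Set (WTree (Option ι) (Event α K))) : MeasurableSet {ω | witness L V R t m ω ∈ S} := by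
  induction m generalizing t S with
  | zero => exact MeasurableSet.const (WTree.nil ∈ S)
  | succ m ih =>
    have : {ω | witness L V R t (m + 1) ω ∈ S} = ⋃ o : Option (Event α K),
        {ω | runEvent L V R t ω = o} ∩ {ω | witness L V R (t + 1) m ω ∈
          {τ | (o.elim τ fun e => τ.step (Allowed L) e) ∈ S}} := by
      ext ω
      simp [witness]
    rw [this]
    exact MeasurableSet.iUnion fun o => (h.measurableSet_runEvent t o).inter (ih _ _)

theorem measurableSet_reaches (h : IsExecution p ℬ L Q P X V R) (t n : ℕ)
    (τ : WTree (Option ι) (Event α K)) : MeasurableSet (reaches L V R t n τ) := by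
  have : reaches L V R t n τ = ⋃ m ∈ Set.Iic n, {ω | witness L V R t m ω ∈ ({τ} : Set _)} := by
    ext ω
    simp [reaches]
  rw [this]
  exact MeasurableSet.biUnion (Set.to_countable _) fun m _ => h.measurableSet_witness t m _

theorem measurableSet_resampling (h : IsExecution p ℬ L Q P X V R) (t : ℕ) :
    MeasurableSet {ω | V t ω ≠ none ∧ (R t ω).Nonempty} :=
  (h.measurableSet_running t).inter (h.measurableSet_resampled t {Y | Y.Nonempty})

variable [IsProbabilityMeasure P]

/-- The empty set is chosen with conditional probability at most `q`. -/
theorem real_history_inter_empty_le (h : IsExecution p ℬ L Q P X V R)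
    (hQ : ∀ k, IsFracHittingSet (Q k) (labelClass L k)) {q : ℝ} (hq : ∀ B, Q (L B) ∅ ≤ q)
    (n t : ℕ) (x : ℕ → ∀ i, α i) (v : ℕ → Option ↥ℬ) (y : ℕ → Finset (Elem α)) :
    P.real (history X V R t x v y ∩ ({ω | V (t + n) ω ≠ none} ∩ {ω | R (t + n) ω = ∅})) ≤
      q * P.real (history X V R t x v y ∩ {ω | V (t + n) ω ≠ none}) := by
  classical
  induction n generalizing t x v y with
  | zero =>
    rw [add_zero, ← Set.inter_assoc]
    cases hv : v t with
    | none =>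
      have : history X V R t x v y ∩ {ω | V t ω ≠ none} = ∅ := by
        refine Set.eq_empty_of_forall_notMem fun ω hω => hω.2 ?_
        rw [(hω.1.1 t le_rfl).2, hv]
      simp [this]
    | some B =>
      have : history X V R t x v y ∩ {ω | V t ω ≠ none} = history X V R t x v y := by
        refine Set.inter_eq_left.2 fun ω hω => ?_
        change V t ω ≠ none
        rw [(hω.1 t le_rfl).2, hv]
        simp
      rw [this, h.real_select fun k => (hQ k).nonneg, hv, mul_comm]
      exact mul_le_mul_of_nonneg_right ((selectProb_le hQ B ∅).trans (hq B)) measureReal_nonneg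
  | succ n ih =>
    -- The rule for selecting is known only given a full history, so the history is refined step by
    -- step up to the time in question.
    have hn : t + (n + 1) = t + 1 + n := by omega
    have hsplit : ∀ E, P.real (history X V R t x v y ∩ E) =
        ∑ Y, P.real (history X V R t x v y ∩ {ω | R t ω = Y} ∩ E) := by
      intro E
      rw [← sum_measureReal_inter_fiber P (h.measurable_resampled t)]
      exact Finset.sum_congr rfl fun Y _ => by rw [Set.inter_right_comm]
    rw [hn, hsplit, hsplit, Finset.mul_sum]
    refine Finset.sum_le_sum fun Y _ => ?_
    rw [h.real_inter_eq_sum, h.real_inter_eq_sum, Finset.mul_sum]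
    refine Finset.sum_le_sum fun x' _ => ?_
    rw [Finset.mul_sum]
    exact Finset.sum_le_sum fun v' _ => ih _ _ _ _

theorem real_empty_le (h : IsExecution p ℬ L Q P X V R)
    (hQ : ∀ k, IsFracHittingSet (Q k) (labelClass L k)) {q : ℝ} (hq : ∀ B, Q (L B) ∅ ≤ q)
    (t : ℕ) : P.real {ω | V t ω ≠ none ∧ R t ω = ∅} ≤ q * P.real {ω | V t ω ≠ none} := by
  classical
  have hsplit : ∀ E : Set Ω, P.real E = ∑ x : ∀ i, α i, ∑ v : Option ↥ℬ,
      P.real (history X V R 0 (fun _ => x) (fun _ => v) (fun _ => ∅) ∩ E) := by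
    intro E
    rw [← sum_measureReal_inter_fiber P (h.measurable_assignment 0)]
    refine Finset.sum_congr rfl fun x _ => ?_
    rw [← sum_measureReal_inter_fiber P (h.measurable_violated 0)]
    refine Finset.sum_congr rfl fun v _ => ?_
    congr 1
    ext ω
    simp [history]
    tauto
  rw [hsplit, hsplit {ω | V t ω ≠ none}, Finset.mul_sum]
  refine Finset.sum_le_sum fun x _ => ?_
  rw [Finset.mul_sum]
  refine Finset.sum_le_sum fun v _ => ?_
  have := h.real_history_inter_empty_le hQ hq t 0 (fun _ => x) (fun _ => v) fun _ => ∅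
  rwa [zero_add] at this

open Classical in
/-- The expected number of resamplings among the first `N` iterations. -/
theorem sum_measure_resampling_le (h : IsExecution p ℬ L Q P X V R)
    (hQ : ∀ k, IsFracHittingSet (Q k) (labelClass L k)) (hp : ∀ e, 0 ≤ p e)
    (hp1 : ∀ i, ∑ a, p ⟨i, a⟩ = 1) {b : ℝ}
    (hb : ∀ S : Finset (WTree (Option ι) (Event α K)), (∀ τ ∈ S, τ.Valid (Allowed L) ∧
      ∃ f, τ.get [] = some f ∧ f.2.Nonempty) → ∑ τ ∈ S, τ.weight (eventWeight Q p) ≤ b)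
    (N : ℕ) : ∑ t ∈ Finset.range N, P {ω | V t ω ≠ none ∧ (R t ω).Nonempty} ≤
      ENNReal.ofReal b := by
  have hfin : (⋃ m ∈ Finset.range (N + 1), Set.range (witness L V R 0 m)).Finite :=
    Set.Finite.biUnion (Finset.finite_toSet _) fun m _ => finite_range_witness L V R 0 m
  -- All trees with a nonempty root set that can appear within N iterations; there are finitely
  -- many, although the tree type is infinite.
  set S := hfin.toFinset.filter fun τ => ∃ f, τ.get [] = some f ∧ f.2.Nonempty with hS
  have hSv : ∀ τ ∈ S, τ.Valid (Allowed L) ∧ ∃ f, τ.get [] = some f ∧ f.2.Nonempty := by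
    intro τ hτ
    obtain ⟨h1, h2⟩ := Finset.mem_filter.1 hτ
    simp only [Set.Finite.mem_toFinset, Set.mem_iUnion] at h1
    obtain ⟨m, -, ω, rfl⟩ := h1
    exact ⟨witness_valid _ _ _ _ _ _, h2⟩
  have hind : ∀ A : Set Ω, MeasurableSet A → P A = ∫⁻ ω, A.indicator 1 ω ∂P := fun A hA =>
    (lintegral_indicator_one hA).symm
  calc _ = ∫⁻ ω, ∑ t ∈ Finset.range N,
        {ω | V t ω ≠ none ∧ (R t ω).Nonempty}.indicator 1 ω ∂P := by
        rw [lintegral_finsetSum _ fun t _ =>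
          measurable_one.indicator (h.measurableSet_resampling t)]
        exact Finset.sum_congr rfl fun t _ => hind _ (h.measurableSet_resampling t)
    _ ≤ ∫⁻ ω, ∑ τ ∈ S, (reaches L V R 0 N τ).indicator 1 ω ∂P := by
        refine lintegral_mono fun ω => ?_
        simp only [Set.indicator_apply, Pi.one_apply, Finset.sum_boole]
        -- Pointwise in ω, the resamplings inject into the trees reached.
        refine Nat.cast_le.2 (Finset.card_le_card_of_injOn (fun t => witness L V R 0 (t + 1) ω)
          ?_ ?_)
        · intro t ht
          obtain ⟨ht, hv, hne⟩ := Finset.mem_filter.1 ht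
          obtain ⟨B, hB⟩ := Option.ne_none_iff_exists'.1 hv
          rw [Finset.mem_range] at ht
          have hr := witness_root (L := L) (V := V) (R := R) (t := 0) (m := t) (ω := ω)
            (e := (L B, R t ω)) (by simp [runEvent, hB])
          refine Finset.mem_filter.2 ⟨Finset.mem_filter.2 ⟨?_, _, hr, hne⟩, ?_⟩
          · simp only [Set.Finite.mem_toFinset, Set.mem_iUnion]
            exact ⟨t + 1, Finset.mem_range.2 (by omega), ω, rfl⟩
          · exact ⟨t + 1, ht, rfl⟩
        · have key : ∀ s t, s < t → (V s ω ≠ none ∧ (R s ω).Nonempty) →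
              (V t ω ≠ none ∧ (R t ω).Nonempty) →
              witness L V R 0 (s + 1) ω ≠ witness L V R 0 (t + 1) ω := by
            rintro s t hst ⟨hv, hne⟩ ⟨hv', hne'⟩
            obtain ⟨B, hB⟩ := Option.ne_none_iff_exists'.1 hv
            obtain ⟨B', hB'⟩ := Option.ne_none_iff_exists'.1 hv'
            exact witness_ne (e := (L B, R s ω)) (f := (L B', R t ω)) hst hne
              (by simp [runEvent, hB]) (by simp [runEvent, hB'])
          intro s hs t ht hst
          have hs := (Finset.mem_filter.1 hs).2
          have ht := (Finset.mem_filter.1 ht).2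
          rcases lt_trichotomy s t with hlt | heq | hlt
          · exact absurd hst (key s t hlt hs ht)
          · exact heq
          · exact absurd hst.symm (key t s hlt ht hs)
    _ = ∑ τ ∈ S, P (reaches L V R 0 N τ) := by
        rw [lintegral_finsetSum _ fun τ _ =>
          measurable_one.indicator (h.measurableSet_reaches 0 N τ)]
        exact Finset.sum_congr rfl fun τ _ => (hind _ (h.measurableSet_reaches 0 N τ)).symm
    _ ≤ ∑ τ ∈ S, ENNReal.ofReal (τ.weight (eventWeight Q p)) := by
        refine Finset.sum_le_sum fun τ _ => ?_
        rw [← ofReal_measureReal]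
        exact ENNReal.ofReal_le_ofReal (h.real_reaches_le hQ hp hp1 N τ)
    _ ≤ _ := by
        rw [← ENNReal.ofReal_sum_of_nonneg fun τ _ =>
          WTree.weight_nonneg (eventWeight_nonneg (fun k => (hQ k).nonneg) hp) τ]
        exact ENNReal.ofReal_le_ofReal (hb S hSv)

end IsExecution

theorem lintegral_encard_eq_tsum {A : ℕ → Set Ω} (hA : ∀ t, MeasurableSet (A t)) :
    ∫⁻ ω, ({t : ℕ | ω ∈ A t}.encard : ℝ≥0∞) ∂P = ∑' t, P (A t) := by
  have : ∀ ω, ({t : ℕ | ω ∈ A t}.encard : ℝ≥0∞) = ∑' t, (A t).indicator 1 ω := by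
    intro ω
    rw [← ENNReal.tsum_set_one, tsum_subtype {t : ℕ | ω ∈ A t} fun _ => (1 : ℝ≥0∞)]
    rfl
  simp_rw [this]
  rw [lintegral_tsum fun t => (measurable_one.indicator (hA t)).aemeasurable]
  exact tsum_congr fun t => lintegral_indicator_one (hA t)

end Main

end PRA

/-! ### Reduction to condition (a), termination and the two bounds -/

theorem theorem3p3 {ι : Type*} [Fintype ι] {α : ι → Type*} [∀ i, Fintype (α i)] {K : ℕ}
    (ℬ : Finset (Finset (PRA.Elem α))) (hℬ : ∀ B ∈ ℬ, PRA.IsAtomic B)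
    (L : ↥ℬ → Fin K)
    (Q : Fin K → Finset (PRA.Elem α) → ℝ)
    (hQ : ∀ k, PRA.IsFracHittingSet (Q k) (PRA.labelClass L k))
    (lam : PRA.Elem α → ℝ) (hlam : ∀ e, 0 ≤ lam e)
    (hcond :
      ((∀ k, PRA.Smax L Q lam k < 1) ∧
        ∀ i, 1 + ∑ k, PRA.Gvar (Q k) lam i / (1 - PRA.Smax L Q lam k) ≤ PRA.rowSum lam i) ∨
      ((∀ k, PRA.Gtot (Q k) lam < 1) ∧
        ∀ i, 1 + ∑ k, PRA.Gvar (Q k) lam i / (1 - PRA.Gtot (Q k) lam) ≤ PRA.rowSum lam i) ∨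
      ((∀ k Y Y', 0 < Q k Y → 0 < Q k Y' → ¬ PRA.Bowtie L k Y Y') ∧
        ∀ i, 1 + ∑ k, PRA.Gvar (Q k) lam i ≤ PRA.rowSum lam i))
    {Ω : Type*} [MeasurableSpace Ω] (P : MeasureTheory.Measure Ω)
    [MeasureTheory.IsProbabilityMeasure P]
    (X : ℕ → Ω → ∀ i, α i) (V : ℕ → Ω → Option ↥ℬ) (R : ℕ → Ω → Finset (PRA.Elem α))
    (hexec : PRA.IsExecution (fun e => lam e / PRA.rowSum lam e.1) ℬ L Q P X V R) :
    (∀ᵐ ω ∂P, ∃ t, ∀ B ∈ ℬ, ¬ PRA.Holds (X t ω) B) ∧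
    (∫⁻ ω, (PRA.numResamplings V R ω : ℝ≥0∞) ∂P ≤ ENNReal.ofReal (∑ i, PRA.rowSum lam i)) ∧
    ((∀ k, Q k ∅ = 0) →
      ∫⁻ ω, (PRA.numIterations V ω : ℝ≥0∞) ∂P ≤ ENNReal.ofReal (∑ i, PRA.rowSum lam i)) := by
  have hQ0 : ∀ k Y, 0 ≤ Q k Y := fun k => (hQ k).nonneg
  obtain ⟨hS, hrow⟩ : (∀ k, PRA.Smax L Q lam k < 1) ∧
      ∀ i, 1 + ∑ k, PRA.Gvar (Q k) lam i / (1 - PRA.Smax L Q lam k) ≤ PRA.rowSum lam i := by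
    rcases hcond with h | ⟨h1, h2⟩ | ⟨h1, h2⟩
    · exact h
    · exact PRA.le_Smax_of_bound hQ0 hlam h1 (PRA.Smax_le_Gtot L hQ0 hlam) h2
    · exact PRA.le_Smax_of_bound hQ0 hlam (b := fun _ => 0) (fun _ => one_pos)
        (fun k => PRA.Smax_le_zero L lam hQ0 k (h1 k)) (by simpa using h2)
  have h1 : ∀ i, 1 ≤ PRA.rowSum lam i := fun i => by
    refine le_trans (le_add_of_nonneg_right (Finset.sum_nonneg fun k _ => ?_)) (hrow i)
    exact div_nonneg (PRA.Gvar_nonneg hQ0 hlam k i) (sub_nonneg.2 (hS k).le)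
  have hp : ∀ e : PRA.Elem α, 0 ≤ lam e / PRA.rowSum lam e.1 := fun e =>
    div_nonneg (hlam e) (zero_le_one.trans (h1 e.1))
  have hp1 : ∀ i, ∑ a : α i, lam ⟨i, a⟩ / PRA.rowSum lam i = 1 := fun i => by
    rw [← Finset.sum_div]
    exact div_self (one_pos.trans_le (h1 i)).ne'
  have hsum := hexec.sum_measure_resampling_le hQ hp hp1
    (PRA.sum_weight_le hQ0 hlam hS hrow h1)
  have htsum : ∑' t, P {ω | V t ω ≠ none ∧ (R t ω).Nonempty} ≤
      ENNReal.ofReal (∑ i, PRA.rowSum lam i) := ENNReal.tsum_le_of_sum_range_le hsum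
  refine ⟨?_, ?_, fun hempty => ?_⟩
  · obtain ⟨q, hq1, hq⟩ : ∃ q < 1, ∀ B, Q (L B) ∅ ≤ q := by
      rcases isEmpty_or_nonempty ↥ℬ with he | he
      · exact ⟨0, one_pos, fun B => he.elim B⟩
      -- There are finitely many bad events, so the largest Q(∅) serves as `q`; it is at most some
      -- S_k, hence below 1.
      · obtain ⟨B₀, hB₀⟩ := Finite.exists_max fun B : ↥ℬ => Q (L B) ∅
        exact ⟨_, (PRA.empty_le_Smax hQ0 hlam L B₀).trans_lt (hS _), hB₀⟩
    have hlim : Filter.Tendsto (fun t => P.real {ω | V t ω ≠ none ∧ (R t ω).Nonempty} / (1 - q))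
        Filter.atTop (nhds 0) := by
      have := ENNReal.tendsto_atTop_zero_of_tsum_ne_top (htsum.trans_lt ENNReal.ofReal_lt_top).ne
      have := (ENNReal.tendsto_toReal ENNReal.zero_ne_top).comp this
      simpa [measureReal_def, Function.comp_def] using this.div_const (1 - q)
    -- From P(running at t) ≤ P(resampling at t) + q · P(running at t). The resampling probabilities
    -- are summable and so tend to 0.
    have hle : ∀ t, P.real {ω | ∀ t, V t ω ≠ none} ≤
        P.real {ω | V t ω ≠ none ∧ (R t ω).Nonempty} / (1 - q) := by
      intro t
      have hmono : P.real {ω | ∀ t, V t ω ≠ none} ≤ P.real {ω | V t ω ≠ none} :=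
        measureReal_mono fun ω hω => hω t
      have hunion : P.real {ω | V t ω ≠ none} ≤
          P.real {ω | V t ω ≠ none ∧ (R t ω).Nonempty} +
            P.real {ω | V t ω ≠ none ∧ R t ω = ∅} := by
        refine (measureReal_mono ?_).trans (measureReal_union_le _ _)
        intro ω hω
        rcases (R t ω).eq_empty_or_nonempty with he | he
        · exact Or.inr ⟨hω, he⟩
        · exact Or.inl ⟨hω, he⟩
      have hempty := hexec.real_empty_le hQ hq t
      rw [le_div_iff₀ (sub_pos.2 hq1)]
      nlinarith
    have hzero : P.real {ω | ∀ t, V t ω ≠ none} = 0 :=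
      le_antisymm (ge_of_tendsto' hlim hle) measureReal_nonneg
    rw [measureReal_eq_zero_iff] at hzero
    filter_upwards [compl_mem_ae_iff.2 hzero] with ω hω
    obtain ⟨t, ht⟩ : ∃ t, V t ω = none := by
      by_contra hcon
      exact hω fun t ht => hcon ⟨t, ht⟩
    exact ⟨t, fun B hB => (hexec.stop_iff t ω).1 ht ⟨B, hB⟩⟩
  · exact (PRA.lintegral_encard_eq_tsum hexec.measurableSet_resampling).trans_le htsum
  · refine (PRA.lintegral_encard_eq_tsum hexec.measurableSet_running).trans_le
      (le_trans (ENNReal.tsum_le_tsum fun t => ?_) htsum)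
    -- With `q` equal to 0, almost every iteration is a resampling.
    have h0 : P {ω | V t ω ≠ none ∧ R t ω = ∅} = 0 := by
      have := hexec.real_empty_le hQ (q := 0) (fun B => (hempty (L B)).le) t
      rw [zero_mul] at this
      exact (measureReal_eq_zero_iff).1 (le_antisymm this measureReal_nonneg)
    calc P {ω | V t ω ≠ none} ≤ P ({ω | V t ω ≠ none ∧ (R t ω).Nonempty} ∪
          {ω | V t ω ≠ none ∧ R t ω = ∅}) := by
          refine measure_mono fun ω hω => ?_
          rcases (R t ω).eq_empty_or_nonempty with he | he
          · exact Or.inr ⟨hω, he⟩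
          · exact Or.inl ⟨hω, he⟩
      _ ≤ _ := (measure_union_le _ _).trans (by rw [h0, add_zero])
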